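/- **Setting.** Let $(X(t))_{t\in\mathbb R}$ be a real centered Gaussian process with stationary increments and semi-variogram $V(h)=\tfrac12\mathbb E[(X(t+h)-X(t))^2]$. Let $\delta_n=n^{-\alpha}$ with $0<\alpha\le 1$ (infill situation: $\alpha=1$; mixed situation: $\alpha<1$). Let $a=(a_j)_{j\in\mathbb Z}$ be a non-zero finitely supported real sequence with zero sum, of length $L$ (last minus first index of its support, plus one) and order $M$, i.e. $\sum_j a_j j^k=0$ for $0\le k<M$ and $\sum_j a_j j^M\ne0$. Put $$\Delta_{a,i}(f)=\sum_j a_j f((i+j)\delta_n),\qquad V_{a,n}=\sum_{i=1}^{n-L+1}\bigl(\Delta_{a,i}(X)\bigr)^2,\qquad a^{2*}_j=\sum_{k-l=j}a_k a_l .$$ For a finitely supported sequence $b$, an integer $i$, a scale $\delta>0$ and a function $f$ put, for integers $q\ge1$, $$R(i,\delta,q,f,b)=-\sum_j b_j\,j^q\int_0^1\frac{(1-\eta)^{q-1}}{(q-1)!}\,f((i+j\eta)\delta)\,d\eta,$$ and $R(i,\delta,0,f,b)=-\sum_j b_j f((i+j)\delta)$. **Assumptions.** Here $D\ge0$ is an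 integer, $C>0$ and $0<s<2$. * (H0) $V$ is $C^\infty$ on $(0,\infty)$. * (H1) $V$ is $2D$ times differentiable on $\mathbb R$ and $V^{(2D)}(h)=V^{(2D)}(0)+C(-1)^D|h|^s+r(h)$ for all $h\in\mathbb R$, with $r(h)=o(|h|^s)$ as $h\to0$; in the mixed situation, moreover, $|r(h)|\le K|h|^s$ for all $|h|>1$, for some constant $K$. * (H2) Let $d=2$ if $s<3/2$ and $d=3$ if $s\ge3/2$. There are $\beta$ with $s-d<\beta<-1/2$ and a constant $K$ such that $|r^{(d)}(h)|\le K|h|^\beta$ for all $0<|h|<1$ in the infill situation, and for all $h\ne0$ in the mixed situation. **Proposition (moments of $V_{a,n}$).** Assume (H0) and (H1). 1. If $M>D$, then, as $n\to\infty$, $$\mathbb E[V_{a,n}]=n\,C\,(-1)^D\,\delta_n^{2D+s}\,R(0,1,2D,|\cdot|^s,a^{2*})\,(1+o(1)),$$ and $(-1)^D R(0,1,2D,|\cdot|^s,a^{2*})>0$. 2. If moreover (H2) holds and $M>D+s/2+1/4$, then, as $n\to\infty$, $$\operatorname{Var}(V_{a,n})=2n\,C^2\,\delta_n^{4D+2s}\sum_{i\in\mathbb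 Z}R^2(i,1,2D,|\cdot|^s,a^{2*})\,(1+o(1)),$$ and the series is finite and positive. -/

import Mathlib

open MeasureTheory ProbabilityTheory Filter Topology Asymptotics

namespace QuadVar

noncomputable section

/-! ### The process -/

/-- `X` has stationary increments: for every shift `τ`, the process `t ↦ X (t + τ) - X τ` has the
same finite-dimensional distributions as `t ↦ X t - X 0`. -/
def HasStationaryIncrements {Ω : Type*} [MeasurableSpace Ω] (X : ℝ → Ω → ℝ) (μ : Measure Ω) :
    Prop :=
  ∀ (τ : ℝ) (I : Finset ℝ),
    IdentDistrib (fun ω (t : I) => X ((t : ℝ) + τ) ω - X τ ω)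
      (fun ω (t : I) => X (t : ℝ) ω - X 0 ω) μ μ

/-- The semi-variogram `V(h) = (1/2) E[(X(t+h) - X(t))^2]`, read at `t = 0`; for a process with
stationary increments it does not depend on `t`, see `semivariogram_eq`. -/
def semivariogram {Ω : Type*} [MeasurableSpace Ω] (X : ℝ → Ω → ℝ) (μ : Measure Ω) (h : ℝ) : ℝ :=
  (1 / 2) * ∫ ω, (X h ω - X 0 ω) ^ 2 ∂μ

theorem semivariogram_eq {Ω : Type*} [MeasurableSpace Ω] {X : ℝ → Ω → ℝ} {μ : Measure Ω}
    (hX : HasStationaryIncrements X μ) (t h : ℝ) :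
    semivariogram X μ h = (1 / 2) * ∫ ω, (X (t + h) ω - X t ω) ^ 2 ∂μ := by
  have hm : Measurable (fun x : (({h} : Finset ℝ) → ℝ) => (x ⟨h, by simp⟩) ^ 2) := by fun_prop
  have key := ((hX t {h}).comp hm).integral_eq
  simp only [Function.comp_def] at key
  rw [semivariogram, ← key, add_comm h t]

/-! ### Assumptions on the semi-variogram -/

/-- Assumption (H0): `V` is smooth on the open positive half-line. -/
def AssumptionH0 (V : ℝ → ℝ) : Prop :=
  ContDiffOn ℝ ((⊤ : ℕ∞) : WithTop ℕ∞) V (Set.Ioi 0)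

/-- The remainder `r(h) = V^(2D)(h) - V^(2D)(0) - C (-1)^D |h|^s`. -/
def remainder (V : ℝ → ℝ) (D : ℕ) (C s : ℝ) (h : ℝ) : ℝ :=
  iteratedDeriv (2 * D) V h - iteratedDeriv (2 * D) V 0 - C * (-1) ^ D * |h| ^ s

/-- Assumption (H1), with parameters `D`, `C`, `s`, for the step `δ_n = n^(-α)`. The infill
situation is `α = 1`, the mixed situation is `α < 1`. -/
structure AssumptionH1 (V : ℝ → ℝ) (D : ℕ) (C s α : ℝ) : Prop where
  C_pos : 0 < C
  s_pos : 0 < s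
  s_lt_two : s < 2
  /-- `V` is `2D` times differentiable on the whole line. -/
  differentiable : ∀ k < 2 * D, Differentiable ℝ (iteratedDeriv k V)
  /-- `r(h) = o(|h|^s)` as `h → 0`. -/
  expansion : remainder V D C s =o[𝓝 0] fun h : ℝ => |h| ^ s
  /-- In the mixed situation, `|r(h)| ≤ (Const) |h|^s` for `|h| > 1`. -/
  mixed : α < 1 → ∃ K : ℝ, ∀ h : ℝ, 1 < |h| → |remainder V D C s h| ≤ K * |h| ^ s

/-- The order of the derivative of the remainder that (H2) controls. -/
def remainderOrder (s : ℝ) : ℕ := if s < 3 / 2 then 2 else 3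

/-- Assumption (H2): for some `β` with `s - d < β < -1/2`, where `d = 2` if `s < 3/2` and `d = 3`
otherwise, `|r^(d)(h)| ≤ (Const) |h|^β`, for all `0 < |h| < 1` in the infill situation `α = 1`, and
for all `h ≠ 0` in the mixed situation `α < 1`. -/
def AssumptionH2 (V : ℝ → ℝ) (D : ℕ) (C s α : ℝ) : Prop :=
  ∃ β K : ℝ, s - (remainderOrder s : ℝ) < β ∧ β < -(1 / 2) ∧
    ∀ h : ℝ, h ≠ 0 → (α = 1 → |h| < 1) →
      |iteratedDeriv (remainderOrder s) (remainder V D C s) h| ≤ K * |h| ^ β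

/-! ### Sequences and discrete differences -/

/-- The length `L(a)` of a finitely supported sequence: last index minus first index of its
support, plus one (and `0` for the zero sequence). -/
def seqLength (a : ℤ →₀ ℝ) : ℕ :=
  if h : a.support.Nonempty then (a.support.max' h - a.support.min' h + 1).toNat else 0

/-- The `k`-th moment `∑_j a_j j^k` (with `0^0 = 1`). -/
def moment (a : ℤ →₀ ℝ) (k : ℕ) : ℝ := ∑ j ∈ a.support, a j * (j : ℝ) ^ k

/-- `a` has order `M(a) = M`: its first non-zero moment is the `M`-th one. For `M ≥ 1` this forces
`a` to be non-zero with zero sum. -/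
def HasOrder (a : ℤ →₀ ℝ) (M : ℕ) : Prop :=
  (∀ k < M, moment a k = 0) ∧ moment a M ≠ 0

/-- The convolution `(a * b)_j = ∑_{k - l = j} a_k b_l`. -/
def seqConv (a b : ℤ →₀ ℝ) : ℤ →₀ ℝ :=
  a.sum fun k x => b.sum fun l y => Finsupp.single (k - l) (x * y)

/-- The discrete `a`-difference `Δ_{a,i}(f) = ∑_j a_j f((i + j) δ)` at scale `δ`. -/
def discreteDiff (a : ℤ →₀ ℝ) (δ : ℝ) (i : ℤ) (f : ℝ → ℝ) : ℝ :=
  ∑ j ∈ a.support, a j * f (((i : ℝ) + (j : ℝ)) * δ)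

/-- The functional `R(i, δ, q, f, a)`, with the convention `R(i, δ, 0, f, a) = -Δ_{a,i}(f)`. -/
def R (i : ℤ) (δ : ℝ) (q : ℕ) (f : ℝ → ℝ) (a : ℤ →₀ ℝ) : ℝ :=
  if q = 0 then -discreteDiff a δ i f
  else -∑ j ∈ a.support, a j * (j : ℝ) ^ q *
    ∫ η in (0 : ℝ)..1, (1 - η) ^ (q - 1) / ((q - 1).factorial : ℝ) *
      f (((i : ℝ) + (j : ℝ) * η) * δ)

/-- The observation step `δ_n = n^(-α)`. -/
def step (α : ℝ) (n : ℕ) : ℝ := (n : ℝ) ^ (-α)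

/-- The quadratic `a`-variation `V_{a,n} = ∑_{i=1}^{n'} (Δ_{a,i}(X))^2` with `n' = n - L(a) + 1`
(the empty sum if `n < L(a)`). -/
def quadVariation {Ω : Type*} (X : ℝ → Ω → ℝ) (a : ℤ →₀ ℝ) (α : ℝ) (n : ℕ) (ω : Ω) : ℝ :=
  ∑ i ∈ Finset.Icc 1 (n + 1 - seqLength a),
    (discreteDiff a (step α n) (i : ℤ) fun t => X t ω) ^ 2

end

end QuadVar

namespace QuadVar

/-! ### Finitely supported sequences -/

/-! Because `a` has zero sum, a product of two `a`-differences depends only on squared increments of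
the process. Stationarity of the increments then makes the covariance at lag `k` equal to minus the
discrete difference of the semi-variogram along `b = seqConv a a`. The mean of the quadratic
variation is `n'` times the value at lag `0`. For centered Gaussian pairs `Cov(Z², W²) = 2 Cov(Z,
W)²`, so the variance is a double sum of squared covariances.

Write `V = κ |x|^(2D+s) + regularPart`, with `κ` chosen to match the irregular term of (H1). The
sequence `b` has `2M` vanishing moments. On the power term, homogeneity in `δ` and `2D` integrations
by parts give exactly `C (-1)^D δ^(2D+s) R k` (`neg_discreteDiff_eq`). What is left is
`relativeError`. At a fixed lag it tends to `0`, by a Taylor expansion at the origin and (H1). At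
large lags (H2) and a Taylor expansion away from the origin bound it, uniformly in `n`, by a
multiple of `(|k| + 1 - L)^β`, which is square summable since `β < -1/2`
(`exists_relativeError_le`). Dominated convergence over the lags (`tendsto_sum_sum_sq`) yields the
variance.

Positivity of the constants is spectral (`R_zero_pos`): up to a constant, `|y|^p` is the integral of
a Taylor remainder of `cos (y x)` against `x^(-p-1)`. Summing against `b` kills the Taylor
polynomial and leaves the integral of `|∑ a_k e^(ikx)|² x^(-p-1)`. -/

theorem sum_seqConv (a c : ℤ →₀ ℝ) (F : ℤ → ℝ) :
    ∑ j ∈ (seqConv a c).support, seqConv a c j * F j =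
      ∑ k ∈ a.support, ∑ l ∈ c.support, a k * c l * F (k - l) := by
  have h : (seqConv a c).sum (fun j x => x * F j) =
      a.sum fun k x => c.sum fun l y => x * y * F (k - l) := by
    unfold seqConv
    rw [Finsupp.sum_sum_index (by simp) (by intros; ring)]
    refine Finsupp.sum_congr fun k _ => ?_
    rw [Finsupp.sum_sum_index (by simp) (by intros; ring)]
    refine Finsupp.sum_congr fun l _ => ?_
    rw [Finsupp.sum_single_index (by simp)]
  exact h

/-- Exchanging the two copies of `a` reverses the lag, so the autocorrelation is even. -/
theorem sum_seqConv_self_neg (a : ℤ →₀ ℝ) (F : ℤ → ℝ) :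
    ∑ j ∈ (seqConv a a).support, seqConv a a j * F (-j) =
      ∑ j ∈ (seqConv a a).support, seqConv a a j * F j := by
  rw [sum_seqConv a a fun j => F (-j), sum_seqConv, Finset.sum_comm]
  refine Finset.sum_congr rfl fun k _ => Finset.sum_congr rfl fun l _ => ?_
  rw [neg_sub, mul_comm (a l)]

/-- In the binomial expansion of `(k - l)^q` with `q < 2M`, one of the exponents `t`, `q - t` is
below `M`, and the corresponding moment of `a` vanishes. -/
theorem moment_seqConv_self {a : ℤ →₀ ℝ} {M : ℕ} (ha : ∀ k < M, moment a k = 0) {q : ℕ}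
    (hq : q < 2 * M) : moment (seqConv a a) q = 0 := by
  rw [moment, sum_seqConv a a fun j => (j : ℝ) ^ q]
  have h : ∀ k l : ℤ, a k * a l * ((k - l : ℤ) : ℝ) ^ q =
      ∑ t ∈ Finset.range (q + 1),
        (a k * (k : ℝ) ^ t) * ((a l * (l : ℝ) ^ (q - t)) * ((-1) ^ (q - t) * (q.choose t : ℝ))) := by
    intro k l
    rw [Int.cast_sub, sub_eq_add_neg, add_pow, Finset.mul_sum]
    refine Finset.sum_congr rfl fun t _ => ?_
    rw [neg_pow (l : ℝ)]
    ring
  simp_rw [h]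
  rw [Finset.sum_congr rfl fun k _ => Finset.sum_comm, Finset.sum_comm]
  refine Finset.sum_eq_zero fun t ht => ?_
  simp_rw [← Finset.mul_sum, ← Finset.sum_mul]
  rcases lt_or_ge t M with h | h
  · have := ha t h
    rw [moment] at this
    rw [this, zero_mul]
  · have h' : q - t < M := by have := Finset.mem_range.1 ht; omega
    have := ha _ h'
    rw [moment] at this
    rw [this, zero_mul, mul_zero]

theorem sum_mul_add_pow_eq_zero {b : ℤ →₀ ℝ} {m : ℕ} (hb : ∀ k < m, moment b k = 0) (x y : ℝ)
    {q : ℕ} (hq : q < m) : ∑ j ∈ b.support, b j * (x + y * j) ^ q = 0 := by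
  have h : ∀ j : ℤ, b j * (x + y * j) ^ q =
      ∑ t ∈ Finset.range (q + 1),
        (b j * (j : ℝ) ^ (q - t)) * (x ^ t * y ^ (q - t) * (q.choose t : ℝ)) := by
    intro j
    rw [add_pow, Finset.mul_sum]
    refine Finset.sum_congr rfl fun t _ => ?_
    rw [mul_pow]
    ring
  simp_rw [h]
  rw [Finset.sum_comm]
  refine Finset.sum_eq_zero fun t ht => ?_
  have := hb (q - t) (by omega)
  rw [moment] at this
  rw [← Finset.sum_mul, this, zero_mul]

/-- Lets any Taylor polynomial of degree below `m`, centred anywhere, be subtracted inside a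
discrete difference at no cost. -/
theorem sum_mul_polynomial_eq_zero {b : ℤ →₀ ℝ} {m : ℕ} (hb : ∀ k < m, moment b k = 0)
    (c : ℕ → ℝ) (x y : ℝ) :
    ∑ j ∈ b.support, b j * ∑ q ∈ Finset.range m, c q * (x + y * j) ^ q = 0 := by
  simp_rw [Finset.mul_sum]
  rw [Finset.sum_comm]
  refine Finset.sum_eq_zero fun q hq => ?_
  have := sum_mul_add_pow_eq_zero hb x y (Finset.mem_range.1 hq)
  calc ∑ j ∈ b.support, b j * (c q * (x + y * j) ^ q)
      = c q * ∑ j ∈ b.support, b j * (x + y * j) ^ q := by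
        rw [Finset.mul_sum]; exact Finset.sum_congr rfl fun j _ => by ring
    _ = 0 := by rw [this, mul_zero]

theorem HasOrder.ne_zero {a : ℤ →₀ ℝ} {M : ℕ} (ha : HasOrder a M) : a ≠ 0 := by
  rintro rfl
  exact ha.2 (by simp [moment])

theorem one_le_seqLength {a : ℤ →₀ ℝ} (ha : a ≠ 0) : 1 ≤ seqLength a := by
  have h : a.support.Nonempty := Finsupp.support_nonempty_iff.2 ha
  have := a.support.min'_le_max' h
  rw [seqLength, dif_pos h]
  omega

theorem abs_sub_lt_seqLength {a : ℤ →₀ ℝ} {k l : ℤ} (hk : k ∈ a.support) (hl : l ∈ a.support) :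
    |k - l| < seqLength a := by
  have h : a.support.Nonempty := ⟨k, hk⟩
  have h1 := a.support.min'_le k hk
  have h2 := a.support.min'_le l hl
  have h3 := a.support.le_max' k hk
  have h4 := a.support.le_max' l hl
  rw [seqLength, dif_pos h, abs_lt]
  constructor <;> omega

theorem abs_lt_seqLength_of_mem_support_seqConv {a : ℤ →₀ ℝ} {j : ℤ}
    (hj : j ∈ (seqConv a a).support) : |j| < seqLength a := by
  classical
  have h1 := Finsupp.support_sum hj
  obtain ⟨k, hk, h2⟩ := Finset.mem_biUnion.1 h1
  obtain ⟨l, hl, h3⟩ := Finset.mem_biUnion.1 (Finsupp.support_sum h2)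
  have := Finset.mem_singleton.1 (Finsupp.support_single_subset h3)
  rw [this]
  exact abs_sub_lt_seqLength hk hl

theorem discreteDiff_seqConv (a : ℤ →₀ ℝ) (δ : ℝ) (i : ℤ) (f : ℝ → ℝ) :
    discreteDiff (seqConv a a) δ i f =
      ∑ k ∈ a.support, ∑ l ∈ a.support, a k * a l * f (((i : ℝ) + ((k - l : ℤ) : ℝ)) * δ) :=
  sum_seqConv a a fun j => f (((i : ℝ) + (j : ℝ)) * δ)

theorem discreteDiff_seqConv_neg (a : ℤ →₀ ℝ) (δ : ℝ) (i : ℤ) {f : ℝ → ℝ}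
    (hf : ∀ x, f (-x) = f x) :
    discreteDiff (seqConv a a) δ (-i) f = discreteDiff (seqConv a a) δ i f := by
  rw [discreteDiff, ← sum_seqConv_self_neg a fun j => f ((((-i : ℤ) : ℝ) + (j : ℝ)) * δ)]
  refine Finset.sum_congr rfl fun j _ => ?_
  rw [← hf]
  congr 2
  push_cast
  ring

/-! ### Integration by parts in `R` -/

/-- One integration by parts in `η`. The boundary term at `η = 0` is `f i / q!` times the `q`-th
moment, hence vanishes. For `q = 0` this is the fundamental theorem of calculus, which explains the
convention for `R` at order `0`. -/
theorem R_succ {b : ℤ →₀ ℝ} {q : ℕ} (hb : moment b q = 0) (i : ℤ) {f f' : ℝ → ℝ}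
    (hf : ∀ x, HasDerivAt f (f' x) x) (hf' : Continuous f') :
    R i 1 q f b = R i 1 (q + 1) f' b := by
  have hd : ∀ j : ℤ, ∀ η : ℝ, HasDerivAt (fun η : ℝ => f (((i : ℝ) + (j : ℝ) * η) * 1))
      (f' (((i : ℝ) + (j : ℝ) * η) * 1) * j) η := by
    intro j η
    have h1 : HasDerivAt (fun η : ℝ => ((i : ℝ) + (j : ℝ) * η) * 1) (j : ℝ) η := by
      simpa using ((hasDerivAt_id η).const_mul (j : ℝ)).const_add (i : ℝ)
    exact (hf _).comp η h1
  have hc : ∀ j : ℤ, Continuous fun η : ℝ => f' (((i : ℝ) + (j : ℝ) * η) * 1) * j := by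
    intro j
    fun_prop
  have hfc : Continuous f := continuous_iff_continuousAt.2 fun x => (hf x).continuousAt
  rcases Nat.eq_zero_or_pos q with rfl | hq
  · have hb0 : ∑ j ∈ b.support, b j = 0 := by simpa [moment] using hb
    have key : ∀ j : ℤ, (j : ℝ) ^ 1 * ∫ η in (0 : ℝ)..1, (1 - η) ^ 0 / ((0 : ℕ).factorial : ℝ) *
        f' (((i : ℝ) + (j : ℝ) * η) * 1) = f (((i : ℝ) + (j : ℝ)) * 1) - f i := by
      intro j
      have := intervalIntegral.integral_eq_sub_of_hasDerivAt (a := 0) (b := 1)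
        (fun η _ => hd j η) ((hc j).intervalIntegrable _ _)
      rw [intervalIntegral.integral_mul_const] at this
      simp only [mul_one, mul_zero, add_zero] at this ⊢
      simp only [pow_one, pow_zero, Nat.factorial_zero, Nat.cast_one, div_one, one_mul]
      rw [← this, mul_comm]
    simp only [R, if_true, zero_add, one_ne_zero, if_false, Nat.sub_self, discreteDiff]
    rw [neg_inj]
    have : ∀ j ∈ b.support, b j * (j : ℝ) ^ 1 * ∫ η in (0 : ℝ)..1,
        (1 - η) ^ 0 / ((0 : ℕ).factorial : ℝ) * f' (((i : ℝ) + (j : ℝ) * η) * 1) =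
        b j * f (((i : ℝ) + (j : ℝ)) * 1) - b j * f i := by
      intro j _
      rw [mul_assoc, key, mul_sub]
    rw [Finset.sum_congr rfl this, Finset.sum_sub_distrib, ← Finset.sum_mul, hb0, zero_mul,
      sub_zero]
  · obtain ⟨r, rfl⟩ : ∃ r, q = r + 1 := ⟨q - 1, by omega⟩
    have key : ∀ j : ℤ, ∫ η in (0 : ℝ)..1, (1 - η) ^ r / (r.factorial : ℝ) *
        f (((i : ℝ) + (j : ℝ) * η) * 1) = f i / ((r + 1).factorial : ℝ) +
        j * ∫ η in (0 : ℝ)..1, (1 - η) ^ (r + 1) / ((r + 1).factorial : ℝ) *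
        f' (((i : ℝ) + (j : ℝ) * η) * 1) := by
      intro j
      have hu : ∀ η : ℝ, HasDerivAt (fun η : ℝ => -((1 - η) ^ (r + 1) / ((r + 1).factorial : ℝ)))
          ((1 - η) ^ r / (r.factorial : ℝ)) η := by
        intro η
        have h1 := ((((hasDerivAt_id η).const_sub 1).pow (r + 1)).div_const
          ((r + 1).factorial : ℝ)).neg
        convert! h1 using 1
        have h2 : (r.factorial : ℝ) ≠ 0 := by positivity
        have h3 : ((r : ℝ) + 1) ≠ 0 := by positivity
        rw [Nat.factorial_succ]
        simp only [id, Nat.add_sub_cancel, Nat.cast_mul, Nat.cast_add, Nat.cast_one]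
        field_simp
      have huc : Continuous fun η : ℝ => (1 - η) ^ r / (r.factorial : ℝ) := by fun_prop
      have := intervalIntegral.integral_deriv_mul_eq_sub (a := 0) (b := 1)
        (fun η _ => hu η) (fun η _ => hd j η)
        (huc.intervalIntegrable _ _) ((hc j).intervalIntegrable _ _)
      rw [intervalIntegral.integral_add] at this
      · have e : ∫ η in (0 : ℝ)..1, -((1 - η) ^ (r + 1) / ((r + 1).factorial : ℝ)) *
            (f' (((i : ℝ) + (j : ℝ) * η) * 1) * j) =
            -(j * ∫ η in (0 : ℝ)..1, (1 - η) ^ (r + 1) / ((r + 1).factorial : ℝ) *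
            f' (((i : ℝ) + (j : ℝ) * η) * 1)) := by
          rw [← intervalIntegral.integral_const_mul, ← intervalIntegral.integral_neg]
          refine intervalIntegral.integral_congr fun η _ => ?_
          ring
        rw [e] at this
        simp only [sub_self, ne_eq, Nat.add_eq_zero_iff, one_ne_zero, and_false, not_false_eq_true,
          zero_pow, zero_div, neg_zero, zero_mul, sub_zero, one_pow, mul_zero, add_zero,
          mul_one] at this ⊢
        linear_combination this
      · exact Continuous.intervalIntegrable (by fun_prop) _ _
      · exact Continuous.intervalIntegrable (by fun_prop) _ _
    have hb' : ∑ j ∈ b.support, b j * (j : ℝ) ^ (r + 1) = 0 := hb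
    simp only [R, Nat.add_eq_zero_iff, one_ne_zero, and_false, if_false, Nat.add_sub_cancel]
    rw [neg_inj]
    have : ∀ j ∈ b.support, b j * (j : ℝ) ^ (r + 1) * ∫ η in (0 : ℝ)..1,
        (1 - η) ^ r / (r.factorial : ℝ) * f (((i : ℝ) + (j : ℝ) * η) * 1) =
        b j * (j : ℝ) ^ (r + 1) * (f i / ((r + 1).factorial : ℝ)) +
        b j * (j : ℝ) ^ (r + 1 + 1) * ∫ η in (0 : ℝ)..1,
          (1 - η) ^ (r + 1) / ((r + 1).factorial : ℝ) * f' (((i : ℝ) + (j : ℝ) * η) * 1) := by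
      intro j _
      rw [key]
      ring
    rw [Finset.sum_congr rfl this, Finset.sum_add_distrib, ← Finset.sum_mul, hb', zero_mul,
      zero_add]

theorem R_const_mul (c : ℝ) (b : ℤ →₀ ℝ) (q : ℕ) (i : ℤ) (f : ℝ → ℝ) :
    R i 1 q (fun x => c * f x) b = c * R i 1 q f b := by
  unfold R
  split_ifs with h
  · rw [discreteDiff, discreteDiff, mul_neg, Finset.mul_sum]
    congr 1
    exact Finset.sum_congr rfl fun j _ => by ring
  · rw [mul_neg, Finset.mul_sum]
    congr 1
    refine Finset.sum_congr rfl fun j _ => ?_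
    have : ∀ η : ℝ, (1 - η) ^ (q - 1) / ((q - 1).factorial : ℝ) *
        (c * f (((i : ℝ) + (j : ℝ) * η) * 1)) = c * ((1 - η) ^ (q - 1) / ((q - 1).factorial : ℝ) *
        f (((i : ℝ) + (j : ℝ) * η) * 1)) := fun η => by ring
    simp_rw [this]
    rw [intervalIntegral.integral_const_mul]
    ring

/-! ### Powers of the absolute value -/

theorem hasDerivAt_abs_rpow_mul_self {q : ℝ} (hq : 0 < q) (x : ℝ) :
    HasDerivAt (fun x : ℝ => |x| ^ q * x) ((q + 1) * |x| ^ q) x := by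
  rcases eq_or_ne x 0 with rfl | hx
  · have hc : Continuous fun x : ℝ => |x| ^ q := continuous_abs.rpow_const fun _ => Or.inr hq.le
    have h := hc.tendsto 0
    rw [abs_zero, Real.zero_rpow hq.ne', mul_zero, hasDerivAt_iff_tendsto_slope]
    simp only [abs_zero, Real.zero_rpow hq.ne'] at h
    refine (h.mono_left nhdsWithin_le_nhds).congr' ?_
    filter_upwards [self_mem_nhdsWithin] with y hy
    have hy : y ≠ 0 := hy
    simp [slope_def_field, hy]
  · have h1 := (hasDerivAt_abs hx).rpow_const (p := q) (Or.inl (abs_ne_zero.2 hx))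
    have h2 := h1.mul (hasDerivAt_id x)
    convert! h2 using 1
    have h3 : |x| ^ q = |x| ^ (q - 1) * |x| := by
      rw [← Real.rpow_add_one (abs_ne_zero.2 hx), sub_add_cancel]
    have h4 : (SignType.sign x : ℝ) * x = |x| := sign_mul_self x
    simp only [id, mul_one]
    rw [h3]
    linear_combination (- q * |x| ^ (q - 1)) * h4

/-- The constant `c` with `(|x|^(2 D + s))^(2 D) = c |x|^s`. -/
noncomputable def rpowConst (s : ℝ) (D : ℕ) : ℝ :=
  ∏ k ∈ Finset.range D, ((2 * k + 2 + s) * (2 * k + 1 + s))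

theorem rpowConst_pos {s : ℝ} (hs : 0 < s) (D : ℕ) : 0 < rpowConst s D :=
  Finset.prod_pos fun k _ => by positivity

theorem hasDerivAt_abs_rpow_two_add {p : ℝ} (hp : 0 < p) (x : ℝ) :
    HasDerivAt (fun x : ℝ => |x| ^ (2 + p)) ((2 + p) * (|x| ^ p * x)) x := by
  have := hasDerivAt_abs_rpow x (p := 2 + p) (by linarith)
  rwa [add_sub_cancel_left, mul_assoc] at this

/-- Each induction step spends two integrations by parts, through `|x|^(2+p)`, `|x|^p x` and
`|x|^p`. Since `p > 0`, the derivatives involved are continuous across the origin. -/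
theorem R_abs_rpow {s : ℝ} (hs : 0 < s) (D q : ℕ) {b : ℤ →₀ ℝ}
    (hb : ∀ k < q + 2 * D, moment b k = 0) (i : ℤ) :
    R i 1 q (fun x => |x| ^ (2 * (D : ℝ) + s)) b =
      rpowConst s D * R i 1 (q + 2 * D) (fun x => |x| ^ s) b := by
  induction D generalizing q with
  | zero => simp [rpowConst]
  | succ D ih =>
    have hp : 0 < 2 * (D : ℝ) + s := by positivity
    have e : (2 * ((D + 1 : ℕ) : ℝ) + s) = 2 + (2 * (D : ℝ) + s) := by push_cast; ring
    have hcont : Continuous fun x : ℝ => |x| ^ (2 * (D : ℝ) + s) :=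
      continuous_abs.rpow_const fun _ => Or.inr hp.le
    rw [e, R_succ (hb q (by omega)) i (hasDerivAt_abs_rpow_two_add hp)
      (continuous_const.mul (hcont.mul continuous_id)), R_const_mul,
      R_succ (hb (q + 1) (by omega)) i (hasDerivAt_abs_rpow_mul_self hp)
      (continuous_const.mul hcont), R_const_mul, ih (q + 2) fun k hk => hb k (by omega), rpowConst,
      rpowConst, Finset.prod_range_succ]
    have : q + 2 + 2 * D = q + 2 * (D + 1) := by ring
    rw [this]
    ring

theorem discreteDiff_abs_rpow {s : ℝ} (hs : 0 < s) (D : ℕ) {b : ℤ →₀ ℝ}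
    (hb : ∀ k < 2 * D, moment b k = 0) (i : ℤ) :
    discreteDiff b 1 i (fun x => |x| ^ (2 * (D : ℝ) + s)) =
      -(rpowConst s D * R i 1 (2 * D) (fun x => |x| ^ s) b) := by
  have := R_abs_rpow hs D 0 (b := b) (fun k hk => hb k (by omega)) i
  rw [zero_add] at this
  rw [← this, R, if_pos rfl, neg_neg]

/-! ### Positivity -/

/-- The remainder of order `2 D` of the Taylor series of the cosine, with sign `(-1)^(D+1)`. -/
noncomputable def cosRemainder : ℕ → ℝ → ℝ
  | 0, x => 1 - Real.cos x
  | D + 1, x => x ^ (2 * D + 2) / ((2 * D + 2).factorial : ℝ) - cosRemainder D x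

/-- The derivative of `cosRemainder`. -/
noncomputable def sinRemainder : ℕ → ℝ → ℝ
  | 0, x => Real.sin x
  | D + 1, x => x ^ (2 * D + 1) / ((2 * D + 1).factorial : ℝ) - sinRemainder D x

theorem hasDerivAt_pow_div_factorial (n : ℕ) (x : ℝ) :
    HasDerivAt (fun x : ℝ => x ^ (n + 1) / ((n + 1).factorial : ℝ))
      (x ^ n / (n.factorial : ℝ)) x := by
  convert! (hasDerivAt_pow (n + 1) x).div_const ((n + 1).factorial : ℝ) using 1
  have h2 : (n.factorial : ℝ) ≠ 0 := by positivity
  have h3 : ((n : ℝ) + 1) ≠ 0 := by positivity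
  rw [Nat.factorial_succ]
  simp only [Nat.add_sub_cancel, Nat.cast_mul, Nat.cast_add, Nat.cast_one]
  field_simp

theorem hasDerivAt_cosRemainder (D : ℕ) (x : ℝ) :
    HasDerivAt (cosRemainder D) (sinRemainder D x) x := by
  induction D with
  | zero =>
    have := (Real.hasDerivAt_cos x).const_sub 1
    rwa [neg_neg] at this
  | succ D ih => exact (hasDerivAt_pow_div_factorial (2 * D + 1) x).sub ih

theorem hasDerivAt_sinRemainder_succ (D : ℕ) (x : ℝ) :
    HasDerivAt (sinRemainder (D + 1)) (cosRemainder D x) x := by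
  induction D with
  | zero =>
    have := (hasDerivAt_pow_div_factorial 0 x).sub (Real.hasDerivAt_sin x)
    simp only [pow_zero, Nat.factorial_zero, Nat.cast_one, div_one] at this
    exact this
  | succ D ih => exact (hasDerivAt_pow_div_factorial (2 * D + 2) x).sub ih

theorem cosRemainder_zero (D : ℕ) : cosRemainder D 0 = 0 := by
  induction D with
  | zero => simp [cosRemainder]
  | succ D ih => simp [cosRemainder, ih]

theorem sinRemainder_zero (D : ℕ) : sinRemainder D 0 = 0 := by
  induction D with
  | zero => simp [sinRemainder]
  | succ D ih => simp [sinRemainder, ih]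

theorem cosRemainder_neg (D : ℕ) (x : ℝ) : cosRemainder D (-x) = cosRemainder D x := by
  induction D with
  | zero => simp [cosRemainder]
  | succ D ih =>
    have : Even (2 * D + 2) := ⟨D + 1, by ring⟩
    simp [cosRemainder, ih, this.neg_pow]

theorem continuous_cosRemainder (D : ℕ) : Continuous (cosRemainder D) :=
  continuous_iff_continuousAt.2 fun x => (hasDerivAt_cosRemainder D x).continuousAt

theorem nonneg_of_hasDerivAt_nonneg {f f' : ℝ → ℝ} (hf : ∀ x, HasDerivAt f (f' x) x)
    (h0 : f 0 = 0) (hf' : ∀ x, 0 ≤ x → 0 ≤ f' x) {x : ℝ} (hx : 0 ≤ x) : 0 ≤ f x := by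
  have h : MonotoneOn f (Set.Ici 0) := by
    refine monotoneOn_of_deriv_nonneg (convex_Ici 0)
      (fun y _ => (hf y).continuousAt.continuousWithinAt)
      (fun y _ => (hf y).differentiableAt.differentiableWithinAt) fun y hy => ?_
    rw [(hf y).deriv]
    rw [interior_Ici] at hy
    exact hf' y (le_of_lt hy)
  rw [← h0]
  exact h Set.self_mem_Ici hx hx

/-- The second derivative of a remainder is the previous remainder, and both the remainder and its
first derivative vanish at `0`. -/
theorem cosRemainder_nonneg (D : ℕ) {x : ℝ} (hx : 0 ≤ x) : 0 ≤ cosRemainder D x := by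
  induction D generalizing x with
  | zero => simpa [cosRemainder] using Real.cos_le_one x
  | succ D ih =>
    exact nonneg_of_hasDerivAt_nonneg (hasDerivAt_cosRemainder _) (cosRemainder_zero _)
      (fun y hy => nonneg_of_hasDerivAt_nonneg (hasDerivAt_sinRemainder_succ D)
        (sinRemainder_zero _) (fun z hz => ih hz) hy) hx

/-- Nonnegativity of the next remainder, read as an upper bound. It controls the behaviour near `0`;
`cosRemainder_le_two_mul_pow` serves at infinity. -/
theorem cosRemainder_le_pow (D : ℕ) {x : ℝ} (hx : 0 ≤ x) :
    cosRemainder D x ≤ x ^ (2 * D + 2) := by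
  have h1 := cosRemainder_nonneg (D + 1) hx
  have h2 : x ^ (2 * D + 2) / ((2 * D + 2).factorial : ℝ) ≤ x ^ (2 * D + 2) :=
    div_le_self (by positivity) (by exact_mod_cast Nat.one_le_iff_ne_zero.2 (Nat.factorial_ne_zero _))
  rw [cosRemainder] at h1
  linarith

theorem cosRemainder_le_two_mul_pow (D : ℕ) {x : ℝ} (hx : 0 ≤ x) :
    cosRemainder D x ≤ 2 * x ^ (2 * D) := by
  cases D with
  | zero =>
    have := Real.neg_one_le_cos x
    simp only [cosRemainder, mul_zero, pow_zero, mul_one]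
    linarith
  | succ D =>
    have h1 := cosRemainder_nonneg D hx
    have h2 : x ^ (2 * D + 2) / ((2 * D + 2).factorial : ℝ) ≤ x ^ (2 * D + 2) :=
      div_le_self (by positivity)
        (by exact_mod_cast Nat.one_le_iff_ne_zero.2 (Nat.factorial_ne_zero _))
    have h3 : 0 ≤ x ^ (2 * D + 2) := by positivity
    rw [cosRemainder, mul_add, mul_one]
    linarith

/-- The integrand is `O(x^(1-s))` at `0` and `O(x^(-s-1))` at infinity, so convergence is exactly
where `s < 2` and `0 < s` enter. -/
theorem integrableOn_cosRemainder {s : ℝ} (hs : 0 < s) (hs2 : s < 2) (D : ℕ) :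
    IntegrableOn (fun x => cosRemainder D x * x ^ (-(2 * (D : ℝ) + s) - 1)) (Set.Ioi 0) := by
  have hcont : ContinuousOn (fun x => cosRemainder D x * x ^ (-(2 * (D : ℝ) + s) - 1))
      (Set.Ioi 0) := by
    refine (continuous_cosRemainder D).continuousOn.mul ?_
    exact continuousOn_id.rpow_const fun x hx => Or.inl (ne_of_gt hx)
  have hm := hcont.aestronglyMeasurable (μ := volume) measurableSet_Ioi
  rw [← Set.Ioc_union_Ioi_eq_Ioi zero_le_one]
  refine IntegrableOn.union ?_ ?_
  · have h1 : IntegrableOn (fun x : ℝ => x ^ (1 - s)) (Set.Ioc 0 1) := by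
      rw [← intervalIntegrable_iff_integrableOn_Ioc_of_le zero_le_one]
      exact intervalIntegral.intervalIntegrable_rpow' (by linarith)
    refine h1.mono' (hm.mono_set Set.Ioc_subset_Ioi_self) ?_
    refine (ae_restrict_iff' measurableSet_Ioc).2 (ae_of_all _ fun x hx => ?_)
    have hx0 : 0 < x := hx.1
    rw [Real.norm_eq_abs, abs_of_nonneg
      (mul_nonneg (cosRemainder_nonneg D hx0.le) (Real.rpow_nonneg hx0.le _))]
    calc cosRemainder D x * x ^ (-(2 * (D : ℝ) + s) - 1)
        ≤ x ^ (2 * D + 2) * x ^ (-(2 * (D : ℝ) + s) - 1) :=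
          mul_le_mul_of_nonneg_right (cosRemainder_le_pow D hx0.le) (Real.rpow_nonneg hx0.le _)
      _ = x ^ (1 - s) := by
          rw [← Real.rpow_natCast, ← Real.rpow_add hx0]
          congr 1
          push_cast
          ring
  · have h1 : IntegrableOn (fun x : ℝ => 2 * x ^ (-s - 1)) (Set.Ioi 1) :=
      (integrableOn_Ioi_rpow_of_lt (by linarith) one_pos).const_mul 2
    refine h1.mono' (hm.mono_set (Set.Ioi_subset_Ioi zero_le_one)) ?_
    refine (ae_restrict_iff' measurableSet_Ioi).2 (ae_of_all _ fun x hx => ?_)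
    have hx0 : 0 < x := zero_lt_one.trans hx
    rw [Real.norm_eq_abs, abs_of_nonneg
      (mul_nonneg (cosRemainder_nonneg D hx0.le) (Real.rpow_nonneg hx0.le _))]
    calc cosRemainder D x * x ^ (-(2 * (D : ℝ) + s) - 1)
        ≤ 2 * x ^ (2 * D) * x ^ (-(2 * (D : ℝ) + s) - 1) :=
          mul_le_mul_of_nonneg_right (cosRemainder_le_two_mul_pow D hx0.le)
            (Real.rpow_nonneg hx0.le _)
      _ = 2 * x ^ (-s - 1) := by
          rw [mul_assoc, ← Real.rpow_natCast, ← Real.rpow_add hx0]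
          congr 2
          push_cast
          ring

theorem integral_cosRemainder_mul {p : ℝ} (hp : 0 < p) (D : ℕ) (y : ℝ) :
    ∫ x in Set.Ioi (0 : ℝ), cosRemainder D (y * x) * x ^ (-p - 1) =
      |y| ^ p * ∫ x in Set.Ioi (0 : ℝ), cosRemainder D x * x ^ (-p - 1) := by
  rcases eq_or_ne y 0 with rfl | hy
  · simp [cosRemainder_zero, Real.zero_rpow hp.ne']
  have hy' : 0 < |y| := abs_pos.2 hy
  have habs : ∀ x, cosRemainder D (y * x) = cosRemainder D (|y| * x) := by
    intro x
    rcases abs_choice y with h | h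
    · rw [h]
    · rw [h, neg_mul, cosRemainder_neg]
  -- The factor `|y|^(p+1)` undoes the scaling of `x^(-p-1)`; the Jacobian takes one power back,
  -- leaving `|y|^p`.
  have h := integral_comp_mul_left_Ioi
    (fun x => |y| ^ (p + 1) * (cosRemainder D x * x ^ (-p - 1))) 0 hy'
  rw [mul_zero, integral_const_mul _ fun x => cosRemainder D x * x ^ (-p - 1)] at h
  have e : ∀ x ∈ Set.Ioi (0 : ℝ), cosRemainder D (y * x) * x ^ (-p - 1) =
      |y| ^ (p + 1) * (cosRemainder D (|y| * x) * (|y| * x) ^ (-p - 1)) := by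
    intro x hx
    have hx : 0 < x := hx
    rw [habs, Real.mul_rpow hy'.le hx.le]
    have : |y| ^ (p + 1) * |y| ^ (-p - 1) = 1 := by
      rw [← Real.rpow_add hy']
      simp
    linear_combination (-cosRemainder D (|y| * x) * x ^ (-p - 1)) * this
  rw [setIntegral_congr_fun measurableSet_Ioi e, h, smul_eq_mul, Real.rpow_add_one hy'.ne']
  field_simp

theorem integrableOn_cosRemainder_mul {s : ℝ} (hs : 0 < s) (hs2 : s < 2) (D : ℕ) (y : ℝ) :
    IntegrableOn (fun x => cosRemainder D (y * x) * x ^ (-(2 * (D : ℝ) + s) - 1))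
      (Set.Ioi 0) := by
  rcases eq_or_ne y 0 with rfl | hy
  · simp [cosRemainder_zero]
  have hy' : 0 < |y| := abs_pos.2 hy
  have habs : ∀ x, cosRemainder D (y * x) = cosRemainder D (|y| * x) := by
    intro x
    rcases abs_choice y with h | h
    · rw [h]
    · rw [h, neg_mul, cosRemainder_neg]
  have h := (integrableOn_Ioi_comp_mul_left_iff
    (fun x => cosRemainder D x * x ^ (-(2 * (D : ℝ) + s) - 1)) 0 hy').2
    (by rw [mul_zero]; exact integrableOn_cosRemainder hs hs2 D)
  refine IntegrableOn.congr_fun (h.const_mul (|y| ^ (-(2 * (D : ℝ) + s) - 1))⁻¹)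
    (fun x hx => ?_) measurableSet_Ioi
  have hx : 0 < x := hx
  have : |y| ^ (-(2 * (D : ℝ) + s) - 1) ≠ 0 := (Real.rpow_pos_of_pos hy' _).ne'
  rw [habs, Real.mul_rpow hy'.le hx.le]
  field_simp

/-- The Fourier transform of the autocorrelation is `|∑ a_k e^(ikx)|²`, hence nonnegative. -/
theorem sum_seqConv_cos (a : ℤ →₀ ℝ) (x : ℝ) :
    ∑ j ∈ (seqConv a a).support, seqConv a a j * Real.cos (j * x) =
      (∑ k ∈ a.support, a k * Real.cos (k * x)) ^ 2 +
        (∑ k ∈ a.support, a k * Real.sin (k * x)) ^ 2 := by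
  rw [sum_seqConv a a fun j => Real.cos (j * x), sq, sq, Finset.sum_mul_sum, Finset.sum_mul_sum,
    ← Finset.sum_add_distrib]
  refine Finset.sum_congr rfl fun k _ => ?_
  rw [← Finset.sum_add_distrib]
  refine Finset.sum_congr rfl fun l _ => ?_
  rw [Int.cast_sub, sub_mul, Real.cos_sub]
  ring

theorem sum_mul_cosRemainder {b : ℤ →₀ ℝ} {D : ℕ} (hb : ∀ k ≤ 2 * D, moment b k = 0) (x : ℝ) :
    ∑ j ∈ b.support, b j * cosRemainder D (j * x) =
      (-1) ^ (D + 1) * ∑ j ∈ b.support, b j * Real.cos (j * x) := by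
  induction D with
  | zero =>
    have h : ∑ j ∈ b.support, b j = 0 := by simpa [moment] using hb 0 le_rfl
    simp [cosRemainder, mul_sub, Finset.sum_sub_distrib, h]
  | succ D ih =>
    have h := hb (2 * D + 2) (by omega)
    rw [moment] at h
    simp only [cosRemainder, mul_sub, Finset.sum_sub_distrib]
    rw [ih fun k hk => hb k (by omega), pow_succ _ (D + 1)]
    have : ∑ j ∈ b.support, b j * (((j : ℝ) * x) ^ (2 * D + 2) / ((2 * D + 2).factorial : ℝ)) =
        (∑ j ∈ b.support, b j * (j : ℝ) ^ (2 * D + 2)) *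
          (x ^ (2 * D + 2) / ((2 * D + 2).factorial : ℝ)) := by
      rw [Finset.sum_mul]
      exact Finset.sum_congr rfl fun j _ => by rw [mul_pow]; ring
    rw [this, h]
    ring

/-- The integral over one period is `2π ∑ a_k²`, which is positive. -/
theorem exists_sum_seqConv_cos_ne_zero {a : ℤ →₀ ℝ} (ha : a ≠ 0) :
    ∃ x : ℝ, 0 < x ∧ ∑ j ∈ (seqConv a a).support, seqConv a a j * Real.cos (j * x) ≠ 0 := by
  by_contra! hcon
  have h0 : ∫ x in (0 : ℝ)..2 * Real.pi, ∑ j ∈ (seqConv a a).support,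
      seqConv a a j * Real.cos (j * x) = 0 := by
    rw [intervalIntegral.integral_of_le (by positivity)]
    exact (setIntegral_congr_fun measurableSet_Ioc fun x hx => hcon x hx.1).trans (by simp)
  have hcos : ∀ j : ℤ, ∫ x in (0 : ℝ)..2 * Real.pi, Real.cos (j * x) =
      if j = 0 then 2 * Real.pi else 0 := by
    intro j
    split_ifs with hj
    · simp [hj]
    · have hj' : (j : ℝ) ≠ 0 := by exact_mod_cast hj
      rw [intervalIntegral.integral_comp_mul_left (fun x => Real.cos x) hj', integral_cos]
      have : Real.sin ((j : ℝ) * (2 * Real.pi)) = 0 := by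
        have := Real.sin_int_mul_pi (j * 2)
        rw [← this]
        push_cast
        ring_nf
      simp [this]
  rw [intervalIntegral.integral_finsetSum fun j _ =>
    Continuous.intervalIntegrable (by fun_prop) _ _] at h0
  simp_rw [intervalIntegral.integral_const_mul, hcos] at h0
  rw [sum_seqConv a a fun j => if j = 0 then 2 * Real.pi else 0] at h0
  have h1 : ∀ k ∈ a.support, ∑ l ∈ a.support, a k * a l *
      (if k - l = 0 then 2 * Real.pi else 0) = a k ^ 2 * (2 * Real.pi) := by
    intro k hk
    rw [Finset.sum_eq_single_of_mem k hk fun l _ hl => by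
      rw [if_neg (sub_ne_zero.2 hl.symm), mul_zero]]
    rw [sub_self, if_pos rfl]
    ring
  rw [Finset.sum_congr rfl h1] at h0
  have h2 : 0 < ∑ k ∈ a.support, a k ^ 2 * (2 * Real.pi) := by
    refine Finset.sum_pos (fun k hk => ?_) (Finsupp.support_nonempty_iff.2 ha)
    have := Finsupp.mem_support_iff.1 hk
    positivity
  exact h2.ne' h0

theorem R_zero_pos {a : ℤ →₀ ℝ} {M D : ℕ} {s : ℝ} (hs : 0 < s) (hs2 : s < 2) (hM : HasOrder a M)
    (hD : D < M) :
    0 < (-1) ^ D * R 0 1 (2 * D) (fun x => |x| ^ s) (seqConv a a) := by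
  set b := seqConv a a with hb_def
  have hb : ∀ k < 2 * M, moment b k = 0 := fun k hk => moment_seqConv_self hM.1 hk
  set p : ℝ := 2 * (D : ℝ) + s with hp_def
  have hp : 0 < p := by positivity
  set T : ℝ → ℝ := fun x => ∑ j ∈ b.support, b j * Real.cos (j * x) with hT
  have hTc : Continuous T := by fun_prop
  have hT0 : ∀ x, 0 ≤ T x := fun x => by
    simp only [hT, hb_def]
    rw [sum_seqConv_cos]
    positivity
  set I := ∫ x in Set.Ioi (0 : ℝ), cosRemainder D x * x ^ (-p - 1) with hI
  have hI0 : 0 ≤ I := setIntegral_nonneg measurableSet_Ioi fun x hx =>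
    mul_nonneg (cosRemainder_nonneg D (le_of_lt hx)) (Real.rpow_nonneg (le_of_lt hx) _)
  have hsum : ∀ x, (-1) ^ (D + 1) * ∑ j ∈ b.support, b j * (cosRemainder D (j * x) *
      x ^ (-p - 1)) = T x * x ^ (-p - 1) := by
    intro x
    simp_rw [← mul_assoc]
    rw [← Finset.sum_mul, sum_mul_cosRemainder fun k hk => hb k (by omega), ← mul_assoc,
      ← mul_assoc, ← mul_pow]
    simp [hT]
  have hint : ∀ j ∈ b.support, IntegrableOn (fun x => b j * (cosRemainder D (j * x) *
      x ^ (-p - 1))) (Set.Ioi 0) :=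
    fun j _ => (integrableOn_cosRemainder_mul hs hs2 D j).const_mul _
  have hTint : IntegrableOn (fun x => T x * x ^ (-p - 1)) (Set.Ioi 0) := by
    have : IntegrableOn (fun x => (-1) ^ (D + 1) * ∑ j ∈ b.support, b j * (cosRemainder D (j * x) *
      x ^ (-p - 1))) (Set.Ioi 0) := (integrable_finsetSum _ hint).const_mul _
    simpa only [hsum] using this
  have key : ∫ x in Set.Ioi (0 : ℝ), T x * x ^ (-p - 1) =
      (-1) ^ (D + 1) * (∑ j ∈ b.support, b j * |(j : ℝ)| ^ p) * I := by
    simp_rw [← hsum]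
    rw [integral_const_mul, integral_finsetSum _ hint, mul_assoc, Finset.sum_mul]
    congr 1
    refine Finset.sum_congr rfl fun j _ => ?_
    rw [integral_const_mul, integral_cosRemainder_mul hp, mul_assoc]
  have hpos : 0 < ∫ x in Set.Ioi (0 : ℝ), T x * x ^ (-p - 1) := by
    rw [setIntegral_pos_iff_support_of_nonneg_ae _ hTint]
    · obtain ⟨x, hx, hx'⟩ := exists_sum_seqConv_cos_ne_zero hM.ne_zero
      have hopen : IsOpen ({x | T x ≠ 0} ∩ Set.Ioi 0) :=
        (isOpen_ne_fun hTc continuous_const).inter isOpen_Ioi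
      refine (hopen.measure_pos volume ⟨x, hx', hx⟩).trans_le (measure_mono ?_)
      rintro y ⟨hy, hy0⟩
      exact ⟨mul_ne_zero hy (Real.rpow_pos_of_pos hy0 _).ne', hy0⟩
    · refine (ae_restrict_iff' measurableSet_Ioi).2 (ae_of_all _ fun x hx => ?_)
      exact mul_nonneg (hT0 x) (Real.rpow_nonneg (le_of_lt hx) _)
  rw [key] at hpos
  -- A positive product with `I ≥ 0` forces the other factor to be positive, so `I > 0` needs no
  -- separate proof.
  have h1 := pos_of_mul_pos_left hpos hI0
  have h2 := discreteDiff_abs_rpow hs D (b := b) (fun k hk => hb k (by omega)) 0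
  simp only [discreteDiff, Int.cast_zero, zero_add, mul_one] at h2
  rw [h2] at h1
  have h3 := rpowConst_pos hs D
  have h4 : 0 < rpowConst s D * ((-1) ^ D * R 0 1 (2 * D) (fun x => |x| ^ s) b) := by
    rw [pow_succ] at h1
    linarith
  exact pos_of_mul_pos_right h4 h3.le

/-! ### Gaussian moments -/

theorem integral_pow_four_gaussianReal (v : NNReal) :
    ∫ x, x ^ 4 ∂gaussianReal 0 v = 3 * (v : ℝ) ^ 2 := by
  have he : ∀ t : ℝ, HasDerivAt (fun t : ℝ => Real.exp (v * t ^ 2 / 2))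
      (v * t * Real.exp (v * t ^ 2 / 2)) t := by
    intro t
    have h := (((hasDerivAt_pow 2 t).const_mul (v : ℝ)).div_const 2).exp
    convert! h using 1
    simp
    ring
  -- Cubic polynomials times the moment generating function cover every derivative up to the third,
  -- so one formula serves all four differentiations.
  have hp : ∀ (a b c d e t : ℝ), HasDerivAt
      (fun t : ℝ => (a + b * t + c * t ^ 2 + d * t ^ 3) * Real.exp (v * t ^ 2 / 2))
      ((b + 2 * c * t + 3 * d * t ^ 2 + (a + b * t + c * t ^ 2 + d * t ^ 3) * (v * t)) *
        Real.exp (v * t ^ 2 / 2)) t := by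
    intro a b c d e t
    have h1 : HasDerivAt (fun t : ℝ => a + b * t + c * t ^ 2 + d * t ^ 3)
        (b + 2 * c * t + 3 * d * t ^ 2) t := by
      have := ((((hasDerivAt_id t).const_mul b).const_add a).add
        ((hasDerivAt_pow 2 t).const_mul c)).add ((hasDerivAt_pow 3 t).const_mul d)
      convert! this using 1
      simp
      ring
    convert! h1.mul (he t) using 1
    ring
  have e1 : deriv (fun t : ℝ => Real.exp (v * t ^ 2 / 2)) =
      fun t => (0 + v * t + 0 * t ^ 2 + 0 * t ^ 3) * Real.exp (v * t ^ 2 / 2) := by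
    ext t
    rw [(he t).deriv]
    ring
  have e2 : deriv (fun t : ℝ => (0 + v * t + 0 * t ^ 2 + 0 * t ^ 3) * Real.exp (v * t ^ 2 / 2)) =
      fun t => (v + 0 * t + v ^ 2 * t ^ 2 + 0 * t ^ 3) * Real.exp (v * t ^ 2 / 2) := by
    ext t
    rw [(hp _ _ _ _ 0 t).deriv]
    ring
  have e3 : deriv (fun t : ℝ => (v + 0 * t + v ^ 2 * t ^ 2 + 0 * t ^ 3) *
      Real.exp (v * t ^ 2 / 2)) =
      fun t => (0 + 3 * v ^ 2 * t + 0 * t ^ 2 + v ^ 3 * t ^ 3) * Real.exp (v * t ^ 2 / 2) := by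
    ext t
    rw [(hp _ _ _ _ 0 t).deriv]
    ring
  have key : ∫ x, x ^ 4 ∂gaussianReal 0 v =
      iteratedDeriv 4 (mgf (fun x ↦ x) (gaussianReal 0 v)) 0 := by
    rw [iteratedDeriv_mgf_zero] <;> simp
  rw [key, mgf_fun_id_gaussianReal]
  simp only [zero_mul, zero_add]
  rw [iteratedDeriv_succ', iteratedDeriv_succ', iteratedDeriv_succ', iteratedDeriv_one, e1, e2, e3,
    (hp _ _ _ _ 0 0).deriv]
  simp

variable {Ω : Type*} [MeasurableSpace Ω] {μ : Measure Ω}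

theorem integral_pow_four_of_hasGaussianLaw {Z : Ω → ℝ} (hZ : HasGaussianLaw Z μ)
    (h0 : ∫ ω, Z ω ∂μ = 0) : ∫ ω, Z ω ^ 4 ∂μ = 3 * (∫ ω, Z ω ^ 2 ∂μ) ^ 2 := by
  have hm := hZ.aemeasurable
  have hmap := hZ.map_eq_gaussianReal
  rw [h0] at hmap
  have h1 : ∫ ω, Z ω ^ 4 ∂μ = ∫ x, x ^ 4 ∂(μ.map Z) :=
    (integral_map hm (continuous_pow 4).aestronglyMeasurable).symm
  rw [h1, hmap, integral_pow_four_gaussianReal, Real.coe_toNNReal _ (variance_nonneg _ _),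
    variance_of_integral_eq_zero hm h0]

theorem integrable_pow_of_hasGaussianLaw {Z : Ω → ℝ} (hZ : HasGaussianLaw Z μ) (n : ℕ) :
    Integrable (fun ω => Z ω ^ n) μ := by
  have := hZ.isProbabilityMeasure
  have h := hZ.memLp (p := (n : ENNReal)) (by simp)
  exact h.integrable_norm_pow'.mono' (hZ.aemeasurable.pow_const n).aestronglyMeasurable
    (ae_of_all _ fun ω => by simp)

theorem integrable_mul_of_hasGaussianLaw {Z W : Ω → ℝ}
    (h : HasGaussianLaw (fun ω => (Z ω, W ω)) μ) : Integrable (fun ω => Z ω * W ω) μ := by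
  have h1 := integrable_pow_of_hasGaussianLaw h.fun_add 2
  have h2 := integrable_pow_of_hasGaussianLaw h.fun_sub 2
  refine ((h1.sub h2).const_mul (1 / 4)).congr (ae_of_all _ fun ω => ?_)
  simp only [Pi.sub_apply]
  ring

/-- Polarization: `12 Z²W² = (Z+W)⁴ + (Z-W)⁴ - 2Z⁴ - 2W⁴`, and each term is the fourth power of a
centered Gaussian variable, with expectation three times the squared variance. -/
theorem integral_sq_mul_sq_of_hasGaussianLaw {Z W : Ω → ℝ}
    (h : HasGaussianLaw (fun ω => (Z ω, W ω)) μ) (hZ : ∫ ω, Z ω ∂μ = 0) (hW : ∫ ω, W ω ∂μ = 0) :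
    ∫ ω, Z ω ^ 2 * W ω ^ 2 ∂μ =
      (∫ ω, Z ω ^ 2 ∂μ) * (∫ ω, W ω ^ 2 ∂μ) + 2 * (∫ ω, Z ω * W ω ∂μ) ^ 2 := by
  have iZ := integrable_pow_of_hasGaussianLaw h.fst
  have iW := integrable_pow_of_hasGaussianLaw h.snd
  have iA := integrable_pow_of_hasGaussianLaw h.fun_add
  have iS := integrable_pow_of_hasGaussianLaw h.fun_sub
  have iZW := integrable_mul_of_hasGaussianLaw h
  have i1Z : Integrable Z μ := by simpa using iZ 1
  have i1W : Integrable W μ := by simpa using iW 1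
  have mZ := integral_pow_four_of_hasGaussianLaw h.fst hZ
  have mW := integral_pow_four_of_hasGaussianLaw h.snd hW
  have mA := integral_pow_four_of_hasGaussianLaw h.fun_add
    (by rw [integral_add i1Z i1W, hZ, hW, add_zero])
  have mS := integral_pow_four_of_hasGaussianLaw h.fun_sub
    (by rw [integral_sub i1Z i1W, hZ, hW, sub_zero])
  have i3 : Integrable (fun ω => Z ω ^ 2 - 2 * (Z ω * W ω)) μ := (iZ 2).sub (iZW.const_mul 2)
  have i5 : Integrable (fun ω => ((Z ω + W ω) ^ 4 + (Z ω - W ω) ^ 4) - 2 * Z ω ^ 4) μ :=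
    ((iA 4).add (iS 4)).sub ((iZ 4).const_mul 2)
  have sA : ∫ ω, (Z ω + W ω) ^ 2 ∂μ =
      ∫ ω, Z ω ^ 2 ∂μ + 2 * ∫ ω, Z ω * W ω ∂μ + ∫ ω, W ω ^ 2 ∂μ := by
    rw [← integral_const_mul, ← integral_add (iZ 2) (iZW.const_mul 2),
      ← integral_add ((iZ 2).fun_add (iZW.const_mul 2)) (iW 2)]
    exact integral_congr_ae (ae_of_all _ fun ω => by simp only; ring)
  have sS : ∫ ω, (Z ω - W ω) ^ 2 ∂μ =
      ∫ ω, Z ω ^ 2 ∂μ - 2 * ∫ ω, Z ω * W ω ∂μ + ∫ ω, W ω ^ 2 ∂μ := by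
    rw [← integral_const_mul, ← integral_sub (iZ 2) (iZW.const_mul 2),
      ← integral_add i3 (iW 2)]
    exact integral_congr_ae (ae_of_all _ fun ω => by simp only; ring)
  have key : ∫ ω, Z ω ^ 2 * W ω ^ 2 ∂μ = (1 / 12) * (((∫ ω, (Z ω + W ω) ^ 4 ∂μ +
      ∫ ω, (Z ω - W ω) ^ 4 ∂μ) - 2 * ∫ ω, Z ω ^ 4 ∂μ) - 2 * ∫ ω, W ω ^ 4 ∂μ) := by
    rw [← integral_const_mul, ← integral_const_mul, ← integral_add (iA 4) (iS 4),
      ← integral_sub ((iA 4).fun_add (iS 4)) ((iZ 4).const_mul 2),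
      ← integral_sub i5 ((iW 4).const_mul 2),
      ← integral_const_mul]
    exact integral_congr_ae (ae_of_all _ fun ω => by simp only; ring)
  rw [key, mA, mS, mZ, mW, sA, sS]
  ring

theorem memLp_sq_of_hasGaussianLaw {Z : Ω → ℝ} (hZ : HasGaussianLaw Z μ) :
    MemLp (fun ω => Z ω ^ 2) 2 μ := by
  rw [memLp_two_iff_integrable_sq (hZ.aemeasurable.pow_const 2).aestronglyMeasurable]
  refine (integrable_pow_of_hasGaussianLaw hZ 4).congr (ae_of_all _ fun ω => ?_)
  simp only
  ring

theorem covariance_sq_sq_of_hasGaussianLaw {Z W : Ω → ℝ}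
    (h : HasGaussianLaw (fun ω => (Z ω, W ω)) μ) (hZ : ∫ ω, Z ω ∂μ = 0) (hW : ∫ ω, W ω ∂μ = 0) :
    covariance (fun ω => Z ω ^ 2) (fun ω => W ω ^ 2) μ = 2 * (∫ ω, Z ω * W ω ∂μ) ^ 2 := by
  have := h.isProbabilityMeasure
  rw [covariance_eq_sub (memLp_sq_of_hasGaussianLaw h.fst) (memLp_sq_of_hasGaussianLaw h.snd)]
  have := integral_sq_mul_sq_of_hasGaussianLaw h hZ hW
  simp only [Pi.mul_apply]
  rw [this]
  ring

/-! ### Discrete differences of the process -/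

variable {X : ℝ → Ω → ℝ}

theorem isGaussianProcess_discreteDiff (hX : IsGaussianProcess X μ) (a : ℤ →₀ ℝ) (δ : ℝ) :
    IsGaussianProcess (fun (i : ℤ) ω => discreteDiff a δ i fun t => X t ω) μ := by
  classical
  refine hX.of_isGaussianProcess fun i => ?_
  let I : Finset ℝ := a.support.image fun j : ℤ => ((i : ℝ) + (j : ℝ)) * δ
  refine ⟨I, ∑ j : a.support, a j • ContinuousLinearMap.proj (R := ℝ) (φ := fun _ : I => ℝ)
    ⟨((i : ℝ) + ((j : ℤ) : ℝ)) * δ, Finset.mem_image_of_mem _ j.2⟩, fun ω => ?_⟩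
  simp only [discreteDiff, FunLike.coe_sum, Finset.sum_apply,
    FunLike.coe_smul, Pi.smul_apply, ContinuousLinearMap.proj_apply, smul_eq_mul,
    Finset.restrict]
  exact (Finset.sum_coe_sort a.support fun j : ℤ => a j * X (((i : ℝ) + (j : ℝ)) * δ) ω).symm

theorem integrable_of_isGaussianProcess (hX : IsGaussianProcess X μ) (t : ℝ) :
    Integrable (X t) μ := by
  simpa using integrable_pow_of_hasGaussianLaw (hX.hasGaussianLaw_eval t) 1

theorem integral_discreteDiff (hX : IsGaussianProcess X μ) (h0 : ∀ t, ∫ ω, X t ω ∂μ = 0)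
    (a : ℤ →₀ ℝ) (δ : ℝ) (i : ℤ) : ∫ ω, discreteDiff a δ i (fun t => X t ω) ∂μ = 0 := by
  simp only [discreteDiff]
  rw [integral_finsetSum _ fun j _ => (integrable_of_isGaussianProcess hX _).const_mul _]
  refine Finset.sum_eq_zero fun j _ => ?_
  rw [integral_const_mul, h0, mul_zero]

/-- Expanding the square, the two pure squares are killed by the zero sum and only the cross term
survives. The point is that the right side sees only increments, since `X` itself need not be
stationary. -/
theorem discreteDiff_mul_discreteDiff {a : ℤ →₀ ℝ} (ha : ∑ j ∈ a.support, a j = 0) (δ : ℝ)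
    (i i' : ℤ) (f : ℝ → ℝ) :
    discreteDiff a δ i f * discreteDiff a δ i' f =
      -(1 / 2) * ∑ k ∈ a.support, ∑ l ∈ a.support, a k * a l *
        (f (((i : ℝ) + k) * δ) - f (((i' : ℝ) + l) * δ)) ^ 2 := by
  have h : ∀ k l : ℤ, a k * a l * (f (((i : ℝ) + k) * δ) - f (((i' : ℝ) + l) * δ)) ^ 2 =
      (a k * f (((i : ℝ) + k) * δ) ^ 2) * a l + a k * (a l * f (((i' : ℝ) + l) * δ) ^ 2) -
      2 * ((a k * f (((i : ℝ) + k) * δ)) * (a l * f (((i' : ℝ) + l) * δ))) := fun k l => by ring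
  simp_rw [h, Finset.sum_sub_distrib, Finset.sum_add_distrib, ← Finset.mul_sum]
  rw [ha]
  simp only [← Finset.sum_mul, ha, discreteDiff]
  simp only [mul_zero, zero_mul, add_zero, zero_sub]
  ring

theorem integral_discreteDiff_mul (hX : IsGaussianProcess X μ) (hS : HasStationaryIncrements X μ)
    {a : ℤ →₀ ℝ} (ha : ∑ j ∈ a.support, a j = 0) (δ : ℝ) (i i' : ℤ) :
    ∫ ω, discreteDiff a δ i (fun t => X t ω) * discreteDiff a δ i' (fun t => X t ω) ∂μ =
      -discreteDiff (seqConv a a) δ (i - i') (semivariogram X μ) := by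
  have hint : ∀ s t : ℝ, Integrable (fun ω => (X s ω - X t ω) ^ 2) μ := fun s t =>
    integrable_pow_of_hasGaussianLaw (hX.hasGaussianLaw_fun_sub (s := s) (t := t)) 2
  simp_rw [discreteDiff_mul_discreteDiff ha]
  rw [integral_const_mul, integral_finsetSum _ fun k _ => integrable_finsetSum _ fun l _ =>
    (hint _ _).const_mul _, discreteDiff_seqConv, neg_mul, neg_inj, Finset.mul_sum]
  refine Finset.sum_congr rfl fun k _ => ?_
  rw [integral_finsetSum _ fun l _ => (hint _ _).const_mul _, Finset.mul_sum]
  refine Finset.sum_congr rfl fun l _ => ?_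
  rw [integral_const_mul, semivariogram_eq hS (((i' : ℝ) + l) * δ)]
  have : ((i' : ℝ) + l) * δ + (((i - i' : ℤ) : ℝ) + ((k - l : ℤ) : ℝ)) * δ =
      ((i : ℝ) + k) * δ := by
    push_cast
    ring
  rw [this]
  ring

theorem semivariogram_neg (hS : HasStationaryIncrements X μ) (h : ℝ) :
    semivariogram X μ (-h) = semivariogram X μ h := by
  rw [semivariogram_eq hS h (-h), add_neg_cancel, semivariogram]
  congr 1
  exact integral_congr_ae (ae_of_all _ fun ω => by simp only; ring)

theorem integral_quadVariation (hX : IsGaussianProcess X μ) (hS : HasStationaryIncrements X μ)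
    {a : ℤ →₀ ℝ} (ha : ∑ j ∈ a.support, a j = 0) (α : ℝ) (n : ℕ) :
    ∫ ω, quadVariation X a α n ω ∂μ = ((n + 1 - seqLength a : ℕ) : ℝ) *
      -discreteDiff (seqConv a a) (step α n) 0 (semivariogram X μ) := by
  have hG := isGaussianProcess_discreteDiff hX a (step α n)
  simp only [quadVariation]
  have hi : ∀ i ∈ Finset.Icc 1 (n + 1 - seqLength a), Integrable (fun ω =>
      (discreteDiff a (step α n) ((i : ℕ) : ℤ) fun t => X t ω) ^ 2) μ := fun i _ =>
    integrable_pow_of_hasGaussianLaw (hG.hasGaussianLaw_eval (i : ℤ)) 2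
  rw [integral_finsetSum _ hi]
  have : ∀ i : ℕ, ∫ ω, (discreteDiff a (step α n) (i : ℤ) fun t => X t ω) ^ 2 ∂μ =
      -discreteDiff (seqConv a a) (step α n) 0 (semivariogram X μ) := by
    intro i
    simp_rw [sq]
    rw [integral_discreteDiff_mul hX hS ha, sub_self]
  simp_rw [this]
  simp

theorem variance_quadVariation (hX : IsGaussianProcess X μ) (h0 : ∀ t, ∫ ω, X t ω ∂μ = 0)
    (hS : HasStationaryIncrements X μ)
    {a : ℤ →₀ ℝ} (ha : ∑ j ∈ a.support, a j = 0) (α : ℝ) (n : ℕ) :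
    variance (quadVariation X a α n) μ =
      ∑ i ∈ Finset.Icc 1 (n + 1 - seqLength a), ∑ i' ∈ Finset.Icc 1 (n + 1 - seqLength a),
        2 * discreteDiff (seqConv a a) (step α n) ((i : ℤ) - (i' : ℤ)) (semivariogram X μ) ^ 2 := by
  have hG := isGaussianProcess_discreteDiff hX a (step α n)
  have : IsProbabilityMeasure μ := hG.isProbabilityMeasure
  have h := variance_fun_sum' (s := Finset.Icc 1 (n + 1 - seqLength a))
    (X := fun (i : ℕ) ω => (discreteDiff a (step α n) (i : ℤ) fun t => X t ω) ^ 2) (μ := μ)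
    fun i _ => memLp_sq_of_hasGaussianLaw (hG.hasGaussianLaw_eval (i : ℤ))
  refine h.trans (Finset.sum_congr rfl fun i _ => Finset.sum_congr rfl fun i' _ => ?_)
  rw [covariance_sq_sq_of_hasGaussianLaw (hG.hasGaussianLaw_prodMk (s := (i : ℤ)) (t := (i' : ℤ)))
    (integral_discreteDiff hX h0 a _ _) (integral_discreteDiff hX h0 a _ _),
    integral_discreteDiff_mul hX hS ha, neg_sq]

/-! ### Taylor expansions -/

/-- Mean value inequality on the ball of radius `|x|`, where `|g'| ≤ ε |x|^p`. -/
theorem isLittleO_abs_rpow_add_one {g g' : ℝ → ℝ} (hg : ∀ x, HasDerivAt g (g' x) x) (h0 : g 0 = 0)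
    {p : ℝ} (hp : 0 ≤ p) (h : g' =o[𝓝 0] fun x : ℝ => |x| ^ p) :
    g =o[𝓝 0] fun x : ℝ => |x| ^ (p + 1) := by
  rw [isLittleO_iff] at h ⊢
  intro ε hε
  obtain ⟨r, hr, hball⟩ := Metric.eventually_nhds_iff.1 (h hε)
  filter_upwards [Metric.ball_mem_nhds (0 : ℝ) hr] with x hx
  have hx' : |x| < r := by simpa using hx
  have hb : ∀ y ∈ Metric.closedBall (0 : ℝ) |x|, ‖g' y‖ ≤ ε * |x| ^ p := by
    intro y hy
    have hy' : |y| ≤ |x| := by simpa using hy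
    refine (hball (by simpa using hy'.trans_lt hx')).trans ?_
    rw [Real.norm_eq_abs, abs_of_nonneg (Real.rpow_nonneg (abs_nonneg y) p)]
    gcongr
  have key := (convex_closedBall (0 : ℝ) |x|).norm_image_sub_le_of_norm_hasDerivWithin_le
    (fun y _ => (hg y).hasDerivWithinAt) hb (x := 0) (y := x) (by simp) (by simp)
  rw [h0, sub_zero, sub_zero, Real.norm_eq_abs x] at key
  rw [Real.norm_of_nonneg (Real.rpow_nonneg (abs_nonneg x) _)]
  rcases eq_or_ne x 0 with rfl | hx0
  · simp [h0, Real.zero_rpow (by linarith : p + 1 ≠ 0)]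
  · rw [Real.rpow_add_one (abs_ne_zero.2 hx0), ← mul_assoc]
    exact key

theorem exists_polynomial_isLittleO {s : ℝ} (hs : 0 ≤ s) (A : ℝ) (m : ℕ) (f : ℝ → ℝ)
    (hf : ∀ k < m, Differentiable ℝ (iteratedDeriv k f))
    (h : (fun x => iteratedDeriv m f x - A) =o[𝓝 0] fun x : ℝ => |x| ^ s) :
    ∃ c : ℕ → ℝ, (fun x => f x - ∑ q ∈ Finset.range (m + 1), c q * x ^ q) =o[𝓝 0]
      fun x : ℝ => |x| ^ ((m : ℝ) + s) := by
  induction m generalizing f with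
  | zero => exact ⟨fun _ => A, by simpa using h⟩
  | succ m ih =>
    obtain ⟨c, hc⟩ := ih (deriv f)
      (fun k hk => by rw [← iteratedDeriv_succ']; exact hf _ (by omega))
      (by rw [← iteratedDeriv_succ']; exact h)
    have hd : Differentiable ℝ f := by simpa using hf 0 (by omega)
    -- Coefficients of the primitive of the polynomial for `deriv f`, with constant term `f 0`.
    refine ⟨fun q => Nat.casesOn q (f 0) fun r => c r / (r + 1), ?_⟩
    have e : ((m + 1 : ℕ) : ℝ) + s = (m + s) + 1 := by push_cast; ring
    rw [e]
    refine isLittleO_abs_rpow_add_one (g' := fun x => deriv f x -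
      ∑ q ∈ Finset.range (m + 1), c q * x ^ q) (fun x => ?_) ?_ (by positivity) hc
    · refine (hd x).hasDerivAt.sub ?_
      simp_rw [Finset.sum_range_succ' _ (m + 1)]
      have h1 : ∀ q ∈ Finset.range (m + 1),
          HasDerivAt (fun x : ℝ => c q / (q + 1) * x ^ (q + 1)) (c q * x ^ q) x := by
        intro q _
        have h2 := (hasDerivAt_pow (q + 1) x).const_mul (c q / (q + 1))
        convert! h2 using 1
        have : (q : ℝ) + 1 ≠ 0 := by positivity
        simp only [Nat.add_sub_cancel, Nat.cast_add, Nat.cast_one]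
        field_simp
      simpa using (HasDerivAt.fun_sum h1).add_const (f 0)
    · simp [Finset.sum_range_succ' _ (m + 1)]

theorem iteratedDeriv_two_mul_abs_rpow {s : ℝ} (hs : 0 < s) (D : ℕ) :
    (∀ k < 2 * D, Differentiable ℝ (iteratedDeriv k fun x : ℝ => |x| ^ (2 * (D : ℝ) + s))) ∧
      iteratedDeriv (2 * D) (fun x : ℝ => |x| ^ (2 * (D : ℝ) + s)) =
        fun x => rpowConst s D * |x| ^ s := by
  induction D with
  | zero => simp [rpowConst]
  | succ D ih =>
    have hp : 0 < 2 * (D : ℝ) + s := by positivity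
    have e : (2 * ((D + 1 : ℕ) : ℝ) + s) = 2 + (2 * (D : ℝ) + s) := by push_cast; ring
    have d1 : deriv (fun x : ℝ => |x| ^ (2 + (2 * (D : ℝ) + s))) =
        fun x => (2 + (2 * (D : ℝ) + s)) * (|x| ^ (2 * (D : ℝ) + s) * x) :=
      funext fun x => (hasDerivAt_abs_rpow_two_add hp x).deriv
    have h2 : ∀ x, HasDerivAt
        (fun x : ℝ => (2 + (2 * (D : ℝ) + s)) * (|x| ^ (2 * (D : ℝ) + s) * x))
        ((2 + (2 * (D : ℝ) + s)) * ((2 * (D : ℝ) + s + 1) * |x| ^ (2 * (D : ℝ) + s))) x :=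
      fun x => (hasDerivAt_abs_rpow_mul_self hp x).const_mul _
    have d2 : deriv (fun x : ℝ => (2 + (2 * (D : ℝ) + s)) * (|x| ^ (2 * (D : ℝ) + s) * x)) =
        fun x => ((2 + (2 * (D : ℝ) + s)) * (2 * (D : ℝ) + s + 1)) * |x| ^ (2 * (D : ℝ) + s) :=
      funext fun x => by rw [(h2 x).deriv, mul_assoc]
    have d3 : ∀ k, iteratedDeriv (k + 2) (fun x : ℝ => |x| ^ (2 * ((D + 1 : ℕ) : ℝ) + s)) =
        fun x => ((2 + (2 * (D : ℝ) + s)) * (2 * (D : ℝ) + s + 1)) *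
          iteratedDeriv k (fun x : ℝ => |x| ^ (2 * (D : ℝ) + s)) x := by
      intro k
      rw [e, iteratedDeriv_succ', iteratedDeriv_succ', d1, d2]
      ext x
      rw [iteratedDeriv_const_mul_field]
    refine ⟨fun k hk => ?_, ?_⟩
    · match k with
      | 0 =>
        rw [iteratedDeriv_zero, e]
        exact fun x => (hasDerivAt_abs_rpow_two_add hp x).differentiableAt
      | 1 =>
        rw [iteratedDeriv_one, e, d1]
        exact fun x => (h2 x).differentiableAt
      | k + 2 =>
        rw [d3]
        exact (ih.1 k (by omega)).const_mul _
    · rw [show 2 * (D + 1) = 2 * D + 2 by ring, d3, ih.2]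
      ext x
      rw [rpowConst, rpowConst, Finset.prod_range_succ]
      ring

/-- Only pointwise differentiability is required, because (H1) gives no continuity of the top
derivative of `V`. -/
theorem iteratedDeriv_sub_of_differentiable {f g : ℝ → ℝ} {m : ℕ}
    (hf : ∀ k < m, Differentiable ℝ (iteratedDeriv k f))
    (hg : ∀ k < m, Differentiable ℝ (iteratedDeriv k g)) {k : ℕ} (hk : k ≤ m) :
    iteratedDeriv k (fun x => f x - g x) = fun x => iteratedDeriv k f x - iteratedDeriv k g x := by
  induction k with
  | zero => simp
  | succ k ih =>
    rw [iteratedDeriv_succ, ih (by omega)]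
    ext x
    rw [deriv_fun_sub (hf k (by omega) x) (hg k (by omega) x), iteratedDeriv_succ,
      iteratedDeriv_succ]

/-- The semi-variogram without its leading irregular term. -/
noncomputable def regularPart (V : ℝ → ℝ) (D : ℕ) (C s : ℝ) (x : ℝ) : ℝ :=
  V x - C * (-1) ^ D / rpowConst s D * |x| ^ (2 * (D : ℝ) + s)

section regularPart

variable {V : ℝ → ℝ} {D : ℕ} {C s α : ℝ}

theorem differentiable_iteratedDeriv_const_mul_abs_rpow (hs : 0 < s) (D : ℕ) (κ : ℝ) {k : ℕ}
    (hk : k < 2 * D) :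
    Differentiable ℝ (iteratedDeriv k fun x : ℝ => κ * |x| ^ (2 * (D : ℝ) + s)) := by
  have : (iteratedDeriv k fun x : ℝ => κ * |x| ^ (2 * (D : ℝ) + s)) =
      fun x => κ * iteratedDeriv k (fun x : ℝ => |x| ^ (2 * (D : ℝ) + s)) x :=
    funext fun x => iteratedDeriv_const_mul_field _ _
  rw [this]
  exact ((iteratedDeriv_two_mul_abs_rpow hs D).1 k hk).const_mul _

theorem iteratedDeriv_regularPart (h : AssumptionH1 V D C s α) {k : ℕ} (hk : k ≤ 2 * D) :
    iteratedDeriv k (regularPart V D C s) = fun x => iteratedDeriv k V x -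
      iteratedDeriv k (fun x : ℝ => C * (-1) ^ D / rpowConst s D * |x| ^ (2 * (D : ℝ) + s)) x :=
  iteratedDeriv_sub_of_differentiable h.differentiable
    (fun _ hk => differentiable_iteratedDeriv_const_mul_abs_rpow h.s_pos D _ hk) hk

theorem differentiable_iteratedDeriv_regularPart (h : AssumptionH1 V D C s α) {k : ℕ}
    (hk : k < 2 * D) : Differentiable ℝ (iteratedDeriv k (regularPart V D C s)) := by
  rw [iteratedDeriv_regularPart h hk.le]
  exact (h.differentiable k hk).sub
    (differentiable_iteratedDeriv_const_mul_abs_rpow h.s_pos D _ hk)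

/-- Dividing by `rpowConst s D` in `regularPart` makes the `2D`-th derivative of the subtracted
power exactly `C (-1)^D |x|^s`. -/
theorem iteratedDeriv_two_mul_regularPart (h : AssumptionH1 V D C s α) :
    iteratedDeriv (2 * D) (regularPart V D C s) =
      fun x => iteratedDeriv (2 * D) V 0 + remainder V D C s x := by
  rw [iteratedDeriv_regularPart h le_rfl]
  ext x
  have := (rpowConst_pos h.s_pos D).ne'
  rw [iteratedDeriv_const_mul_field, (iteratedDeriv_two_mul_abs_rpow h.s_pos D).2, remainder]
  field_simp
  ring

theorem iteratedDeriv_two_mul_add_regularPart (h : AssumptionH1 V D C s α) {d : ℕ} (hd : 0 < d) :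
    iteratedDeriv (2 * D + d) (regularPart V D C s) = iteratedDeriv d (remainder V D C s) := by
  have : iteratedDeriv (2 * D + d) (regularPart V D C s) =
      iteratedDeriv d (iteratedDeriv (2 * D) (regularPart V D C s)) := by
    rw [iteratedDeriv_eq_iterate, iteratedDeriv_eq_iterate, iteratedDeriv_eq_iterate, add_comm,
      Function.iterate_add_apply]
  rw [this, iteratedDeriv_two_mul_regularPart h]
  ext x
  exact iteratedDeriv_const_add hd _

/-- The Taylor polynomial at `0` has degree at most `2D` and is annihilated by `b`; only the
`o(|x|^(2D+s))` remainder is seen. -/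
theorem discreteDiff_regularPart_isLittleO (h : AssumptionH1 V D C s α) {b : ℤ →₀ ℝ}
    (hb : ∀ k ≤ 2 * D, moment b k = 0) (i : ℤ) :
    (fun δ => discreteDiff b δ i (regularPart V D C s)) =o[𝓝 0]
      fun δ : ℝ => |δ| ^ (2 * (D : ℝ) + s) := by
  have hs := h.s_pos
  obtain ⟨c, hc⟩ := exists_polynomial_isLittleO hs.le (iteratedDeriv (2 * D) V 0) (2 * D)
    (regularPart V D C s) (fun k hk => differentiable_iteratedDeriv_regularPart h hk)
    (by simpa [iteratedDeriv_two_mul_regularPart h] using h.expansion)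
  have e : ∀ δ, discreteDiff b δ i (regularPart V D C s) = ∑ j ∈ b.support, b j *
      (regularPart V D C s (((i : ℝ) + j) * δ) -
        ∑ q ∈ Finset.range (2 * D + 1), c q * (((i : ℝ) + j) * δ) ^ q) := by
    intro δ
    have := sum_mul_polynomial_eq_zero (m := 2 * D + 1) (fun k hk => hb k (by omega)) c
      ((i : ℝ) * δ) δ
    simp_rw [mul_sub, Finset.sum_sub_distrib]
    rw [discreteDiff, eq_sub_iff_add_eq, add_eq_left, ← this]
    exact Finset.sum_congr rfl fun j _ => by
      congr 1
      exact Finset.sum_congr rfl fun q _ => by ring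
  simp_rw [e]
  refine IsLittleO.fun_sum fun j _ => IsLittleO.const_mul_left ?_ _
  have ht : Tendsto (fun δ : ℝ => ((i : ℝ) + j) * δ) (𝓝 0) (𝓝 0) := by
    have : Continuous fun δ : ℝ => ((i : ℝ) + j) * δ := by fun_prop
    simpa using this.tendsto 0
  refine (hc.comp_tendsto ht).trans_isBigO ?_
  refine IsBigO.of_bound (|(i : ℝ) + j| ^ (2 * (D : ℝ) + s)) (Eventually.of_forall fun δ => ?_)
  have hn : ∀ x : ℝ, 0 ≤ |x| ^ (2 * (D : ℝ) + s) := fun x => Real.rpow_nonneg (abs_nonneg x) _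
  simp only [Function.comp_apply, Nat.cast_mul, Nat.cast_ofNat]
  rw [Real.norm_of_nonneg (hn _), Real.norm_of_nonneg (hn _), abs_mul,
    Real.mul_rpow (abs_nonneg _) (abs_nonneg _)]

end regularPart

/-! ### Taylor expansion away from the origin and decay at large lags -/

theorem abs_sub_taylor_le {f : ℝ → ℝ}
    (hf : ContDiffOn ℝ ((⊤ : ℕ∞) : WithTop ℕ∞) f (Set.Ioi 0)) {x₀ x B : ℝ} {m : ℕ} (h0 : 0 < x₀)
    (hx : x₀ ≤ x) (hB : ∀ y ∈ Set.Icc x₀ x, |iteratedDeriv (m + 1) f y| ≤ B) :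
    |f x - ∑ q ∈ Finset.range (m + 1), iteratedDeriv q f x₀ / (q.factorial : ℝ) * (x - x₀) ^ q| ≤
      B * (x - x₀) ^ (m + 1) := by
  rcases hx.eq_or_lt with rfl | hx
  · simp [Finset.sum_range_succ']
  have hsub : Set.uIcc x₀ x ⊆ Set.Ioi 0 := by
    rw [Set.uIcc_of_le hx.le]
    exact fun y hy => h0.trans_le hy.1
  obtain ⟨y, hy, he⟩ := taylor_mean_remainder_lagrange_iteratedDeriv (n := m) hx.ne
    ((hf.mono hsub).of_le (by exact_mod_cast le_top))
  rw [Set.uIoo_of_lt hx] at hy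
  have hT : taylorWithinEval f m (Set.uIcc x₀ x) x₀ x =
      ∑ q ∈ Finset.range (m + 1), iteratedDeriv q f x₀ / (q.factorial : ℝ) * (x - x₀) ^ q := by
    rw [taylor_within_apply]
    refine Finset.sum_congr rfl fun q _ => ?_
    rw [iteratedDerivWithin_eq_iteratedDeriv (uniqueDiffOn_uIcc hx.ne)
      ((hf.contDiffAt (Ioi_mem_nhds h0)).of_le (by exact_mod_cast le_top)) Set.left_mem_uIcc,
      smul_eq_mul]
    ring
  rw [← hT, he, abs_div, abs_mul, abs_of_nonneg (pow_nonneg (sub_nonneg.2 hx.le) _)]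
  have hpos : 0 ≤ (x - x₀) ^ (m + 1) := pow_nonneg (sub_nonneg.2 hx.le) _
  refine (div_le_self (by positivity) ?_).trans
    (mul_le_mul_of_nonneg_right (hB y ⟨hy.1.le, hy.2.le⟩) hpos)
  rw [Nat.abs_cast]
  exact_mod_cast Nat.one_le_iff_ne_zero.2 (Nat.factorial_ne_zero _)

theorem abs_discreteDiff_le {f : ℝ → ℝ}
    (hf : ContDiffOn ℝ ((⊤ : ℕ∞) : WithTop ℕ∞) f (Set.Ioi 0)) {b : ℤ →₀ ℝ} {m : ℕ}
    (hb : ∀ k < m + 1, moment b k = 0) {L : ℕ} (hL : ∀ j ∈ b.support, |j| < L) {k : ℤ}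
    (hk : (L : ℤ) ≤ k) {δ B : ℝ} (hδ : 0 < δ) (hB0 : 0 ≤ B)
    (hB : ∀ y, ((k : ℝ) + 1 - L) * δ ≤ y → y ≤ ((k : ℝ) + L - 1) * δ →
      |iteratedDeriv (m + 1) f y| ≤ B) :
    |discreteDiff b δ k f| ≤ (∑ j ∈ b.support, |b j| * (2 * L) ^ (m + 1)) * (B * δ ^ (m + 1)) := by
  -- A lower bound for the sampled points, as `j ≥ 1 - L`. It is positive because `k ≥ L`, so the
  -- expansion stays where `f` is smooth; all points lie within `2 L δ` of it.
  set x₀ : ℝ := ((k : ℝ) + 1 - L) * δ with hx₀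
  have hkL : (1 : ℝ) ≤ (k : ℝ) + 1 - L := by
    have : ((L : ℤ) : ℝ) ≤ k := by exact_mod_cast hk
    push_cast at this
    linarith
  have h0 : 0 < x₀ := mul_pos (by linarith) hδ
  set c : ℕ → ℝ := fun q => iteratedDeriv q f x₀ / (q.factorial : ℝ) with hc
  have e : discreteDiff b δ k f = ∑ j ∈ b.support, b j * (f (((k : ℝ) + j) * δ) -
      ∑ q ∈ Finset.range (m + 1), c q * (((k : ℝ) + j) * δ - x₀) ^ q) := by
    have := sum_mul_polynomial_eq_zero hb c ((k : ℝ) * δ - x₀) δ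
    simp_rw [mul_sub (b _), Finset.sum_sub_distrib]
    rw [discreteDiff, eq_sub_iff_add_eq, add_eq_left, ← this]
    exact Finset.sum_congr rfl fun j _ => by
      congr 1
      exact Finset.sum_congr rfl fun q _ => by ring
  rw [e, Finset.sum_mul]
  refine (Finset.abs_sum_le_sum_abs _ _).trans (Finset.sum_le_sum fun j hj => ?_)
  have hj1 := abs_lt.1 (hL j hj)
  have hj2 : (1 : ℝ) - L ≤ j := by
    have : (1 : ℤ) - L ≤ j := by omega
    exact_mod_cast this
  have hj3 : (j : ℝ) ≤ L - 1 := by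
    have : j ≤ (L : ℤ) - 1 := by omega
    exact_mod_cast this
  have hle : x₀ ≤ ((k : ℝ) + j) * δ := by
    rw [hx₀]
    exact mul_le_mul_of_nonneg_right (by linarith) hδ.le
  have hle' : ((k : ℝ) + j) * δ - x₀ ≤ 2 * L * δ := by
    rw [hx₀, ← sub_mul]
    exact mul_le_mul_of_nonneg_right (by linarith) hδ.le
  have hT := abs_sub_taylor_le hf h0 hle fun y hy => hB y hy.1
    (hy.2.trans (mul_le_mul_of_nonneg_right (by linarith) hδ.le))
  rw [abs_mul, mul_assoc]
  refine mul_le_mul_of_nonneg_left (hT.trans ?_) (abs_nonneg _)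
  have := pow_le_pow_left₀ (sub_nonneg.2 hle) hle' (m + 1)
  rw [mul_pow] at this
  calc B * (((k : ℝ) + j) * δ - x₀) ^ (m + 1) ≤ B * ((2 * L) ^ (m + 1) * δ ^ (m + 1)) :=
        mul_le_mul_of_nonneg_left this hB0
    _ = (2 * L) ^ (m + 1) * (B * δ ^ (m + 1)) := by ring

theorem exists_iteratedDeriv_abs_rpow_eq (p : ℝ) (n : ℕ) :
    ∃ K : ℝ, ∀ y : ℝ, 0 < y → iteratedDeriv n (fun x : ℝ => |x| ^ p) y = K * y ^ (p - n) := by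
  induction n with
  | zero => exact ⟨1, fun y hy => by simp [abs_of_pos hy]⟩
  | succ n ih =>
    obtain ⟨K, hK⟩ := ih
    refine ⟨K * (p - n), fun y hy => ?_⟩
    have he : iteratedDeriv n (fun x : ℝ => |x| ^ p) =ᶠ[𝓝 y] fun y => K * y ^ (p - n) := by
      filter_upwards [Ioi_mem_nhds hy] with z hz using hK z hz
    rw [iteratedDeriv_succ, he.deriv_eq,
      ((Real.hasDerivAt_rpow_const (p := p - n) (Or.inl hy.ne')).const_mul K).deriv]
    push_cast
    rw [← sub_sub, mul_assoc]

theorem contDiffOn_abs_rpow (p : ℝ) :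
    ContDiffOn ℝ ((⊤ : ℕ∞) : WithTop ℕ∞) (fun x : ℝ => |x| ^ p) (Set.Ioi 0) := by
  have h : ContDiffOn ℝ ((⊤ : ℕ∞) : WithTop ℕ∞) (fun x : ℝ => x ^ p) (Set.Ioi 0) :=
    fun x hx => (Real.contDiffAt_rpow_const_of_ne (ne_of_gt hx)).contDiffWithinAt
  exact h.congr fun x hx => by rw [abs_of_pos hx]

theorem exists_abs_discreteDiff_abs_rpow_le {p : ℝ} {m : ℕ} (hpm : p ≤ m + 1) {b : ℤ →₀ ℝ}
    (hb : ∀ k < m + 1, moment b k = 0) {L : ℕ} (hL : ∀ j ∈ b.support, |j| < L) :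
    ∃ K : ℝ, 0 ≤ K ∧ ∀ k : ℤ, (L : ℤ) ≤ k →
      |discreteDiff b 1 k fun x => |x| ^ p| ≤ K * ((k : ℝ) + 1 - L) ^ (p - (m + 1)) := by
  obtain ⟨K, hK⟩ := exists_iteratedDeriv_abs_rpow_eq p (m + 1)
  refine ⟨(∑ j ∈ b.support, |b j| * (2 * L) ^ (m + 1)) * |K|, by positivity, fun k hk => ?_⟩
  have hkL : (0 : ℝ) < (k : ℝ) + 1 - L := by
    have : ((L : ℤ) : ℝ) ≤ k := by exact_mod_cast hk
    push_cast at this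
    linarith
  have h := abs_discreteDiff_le (contDiffOn_abs_rpow p) hb hL hk one_pos
    (B := |K| * ((k : ℝ) + 1 - L) ^ (p - (m + 1)))
    (mul_nonneg (abs_nonneg _) (Real.rpow_nonneg hkL.le _)) fun y hy _ => by
      rw [mul_one] at hy
      have hy0 := hkL.trans_le hy
      rw [hK y hy0, abs_mul, abs_of_pos (Real.rpow_pos_of_pos hy0 _)]
      push_cast
      exact mul_le_mul_of_nonneg_left
        (Real.rpow_le_rpow_of_nonpos hkL hy (by linarith)) (abs_nonneg _)
  rwa [one_pow, mul_one, ← mul_assoc] at h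

/-- Taylor's formula of order `2D + d + 1` gives that power of `δ`, and (H2) at distance about `k δ`
gives a further `(k δ)^β`. The condition for `α = 1` keeps the sampled points inside `(0, 1)`, where
(H2) is available. -/
theorem exists_abs_discreteDiff_regularPart_le {V : ℝ → ℝ} {D : ℕ} {C s α : ℝ}
    (hV : AssumptionH0 V) (h : AssumptionH1 V D C s α) {β K : ℝ} (hβ : β ≤ 0) {d : ℕ}
    (hK : ∀ x : ℝ, x ≠ 0 → (α = 1 → |x| < 1) →
      |iteratedDeriv (d + 1) (remainder V D C s) x| ≤ K * |x| ^ β) {b : ℤ →₀ ℝ}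
    (hb : ∀ k < 2 * D + d + 1, moment b k = 0) {L : ℕ} (hL : ∀ j ∈ b.support, |j| < L) :
    ∃ K' : ℝ, 0 ≤ K' ∧ ∀ (k : ℤ) (δ : ℝ), (L : ℤ) ≤ k → 0 < δ →
      (α = 1 → ((k : ℝ) + L - 1) * δ < 1) →
      |discreteDiff b δ k (regularPart V D C s)| ≤
        K' * δ ^ (2 * (D : ℝ) + (d + 1) + β) * ((k : ℝ) + 1 - L) ^ β := by
  refine ⟨(∑ j ∈ b.support, |b j| * (2 * L) ^ (2 * D + d + 1)) * |K|, by positivity,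
    fun k δ hk hδ hα => ?_⟩
  have hkL : (0 : ℝ) < (k : ℝ) + 1 - L := by
    have : ((L : ℤ) : ℝ) ≤ k := by exact_mod_cast hk
    push_cast at this
    linarith
  have hx₀ : 0 < ((k : ℝ) + 1 - L) * δ := mul_pos hkL hδ
  have hsm : ContDiffOn ℝ ((⊤ : ℕ∞) : WithTop ℕ∞) (regularPart V D C s) (Set.Ioi 0) :=
    ContDiffOn.sub hV (contDiffOn_const.mul (contDiffOn_abs_rpow _))
  have hmain := abs_discreteDiff_le (m := 2 * D + d) hsm hb hL hk hδ
    (B := |K| * (((k : ℝ) + 1 - L) * δ) ^ β)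
    (mul_nonneg (abs_nonneg _) (Real.rpow_nonneg hx₀.le _)) fun y hy hy' => by
      have hy0 := hx₀.trans_le hy
      rw [add_assoc, iteratedDeriv_two_mul_add_regularPart h (Nat.succ_pos d)]
      refine (hK y hy0.ne' fun h1 => ?_).trans ?_
      · rw [abs_of_pos hy0]
        exact hy'.trans_lt (hα h1)
      · rw [abs_of_pos hy0]
        exact mul_le_mul (le_abs_self K) (Real.rpow_le_rpow_of_nonpos hx₀ hy hβ)
          (Real.rpow_nonneg hy0.le _) (abs_nonneg _)
  refine hmain.trans_eq ?_
  have e : δ ^ (2 * (D : ℝ) + (d + 1) + β) = δ ^ β * δ ^ (2 * D + d + 1) := by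
    rw [← Real.rpow_natCast, ← Real.rpow_add hδ]
    congr 1
    push_cast
    ring
  rw [e, Real.mul_rpow hkL.le hδ.le]
  ring

/-! ### Double sums -/

theorem card_filter_sub_eq (N : ℕ) (k : ℤ) :
    (((Finset.Icc 1 N) ×ˢ (Finset.Icc 1 N)).filter
      fun x : ℕ × ℕ => (x.1 : ℤ) - (x.2 : ℤ) = k).card = ((N : ℤ) - |k|).toNat := by
  have h : (((Finset.Icc 1 N) ×ˢ (Finset.Icc 1 N)).filter
      fun x : ℕ × ℕ => (x.1 : ℤ) - (x.2 : ℤ) = k).card =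
      (Finset.Icc (max 1 (1 + k)) (min (N : ℤ) (N + k))).card := by
    refine Finset.card_nbij' (fun x => (x.1 : ℤ)) (fun z => (z.toNat, (z - k).toNat)) ?_ ?_ ?_ ?_
    · intro x hx
      simp only [Finset.coe_filter, Finset.mem_product, Finset.mem_Icc, Set.mem_ofPred_eq] at hx
      simp only [Finset.coe_Icc, Set.mem_Icc]
      omega
    · intro z hz
      simp only [Finset.coe_Icc, Set.mem_Icc] at hz
      simp only [Finset.coe_filter, Finset.mem_product, Finset.mem_Icc, Set.mem_ofPred_eq]
      omega
    · intro x hx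
      simp only [Finset.coe_filter, Finset.mem_product, Finset.mem_Icc, Set.mem_ofPred_eq] at hx
      ext <;> simp only <;> omega
    · intro z hz
      simp only [Finset.coe_Icc, Set.mem_Icc] at hz
      simp only
      omega
  rw [h, Int.card_Icc]
  rcases abs_cases k with h1 | h1 <;> omega

/-- Truncation in `toNat` makes the weights vanish at lags `|k| ≥ N`, so the double sum becomes a
series over a fixed index set, ready for dominated convergence. -/
theorem sum_sum_sub_eq_tsum (F : ℤ → ℝ) (N : ℕ) :
    ∑ i ∈ Finset.Icc 1 N, ∑ i' ∈ Finset.Icc 1 N, F ((i : ℤ) - (i' : ℤ)) =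
      ∑' k : ℤ, (((N : ℤ) - |k|).toNat : ℝ) * F k := by
  rw [tsum_eq_sum (s := Finset.Ioo (-(N : ℤ)) N) fun k hk => by
    have : ((N : ℤ) - |k|).toNat = 0 := by
      rw [Finset.mem_Ioo, ← abs_lt] at hk
      omega
    rw [this, Nat.cast_zero, zero_mul], ← Finset.sum_product',
    ← Finset.sum_fiberwise_of_maps_to (t := Finset.Ioo (-(N : ℤ)) N)
      (g := fun x : ℕ × ℕ => (x.1 : ℤ) - (x.2 : ℤ))]
  · refine Finset.sum_congr rfl fun k _ => ?_
    rw [← card_filter_sub_eq, ← nsmul_eq_mul]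
    exact Finset.sum_eq_card_nsmul fun x hx => by rw [(Finset.mem_filter.1 hx).2]
  · intro x hx
    simp only [Finset.mem_product, Finset.mem_Icc] at hx
    simp only [Finset.mem_Ioo]
    omega

theorem tendsto_natCast_sub_div (L : ℕ) :
    Tendsto (fun n : ℕ => ((n + 1 - L : ℕ) : ℝ) / n) atTop (𝓝 1) := by
  have h : Tendsto (fun n : ℕ => 1 + (1 - (L : ℝ)) / n) atTop (𝓝 (1 + 0)) :=
    tendsto_const_nhds.add (tendsto_const_div_atTop_nhds_zero_nat _)
  rw [add_zero] at h
  refine h.congr' ?_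
  filter_upwards [eventually_ge_atTop L, eventually_gt_atTop 0] with n hn hn0
  have hn0 : (n : ℝ) ≠ 0 := by positivity
  rw [Nat.cast_sub (by omega)]
  push_cast
  field_simp
  ring

theorem tendsto_toNat_sub_abs_div (L : ℕ) (k : ℤ) :
    Tendsto (fun n : ℕ => ((((n + 1 - L : ℕ) : ℤ) - |k|).toNat : ℝ) / n) atTop (𝓝 1) := by
  refine (tendsto_natCast_sub_div (L + k.natAbs)).congr fun n => ?_
  congr 2
  rw [Int.abs_eq_natAbs]
  omega

/-- Each lag has weight tending to `1` and at most `1`, and the terms are dominated by `2 ρ² + 2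
g²`. A bound on `u` is needed only at lags that actually occur. -/
theorem tendsto_sum_sum_sq {ρ g : ℤ → ℝ} {u : ℕ → ℤ → ℝ} (L : ℕ)
    (hρ : Summable fun k => ρ k ^ 2) (hg : Summable fun k => g k ^ 2)
    (hu : ∀ k, Tendsto (fun n => u n k) atTop (𝓝 0))
    (hb : ∀ᶠ n in atTop, ∀ k : ℤ, |k| < ((n + 1 - L : ℕ) : ℤ) → |u n k| ≤ g k)
    (hL : 1 ≤ L) :
    Tendsto (fun n : ℕ => (∑ i ∈ Finset.Icc 1 (n + 1 - L), ∑ i' ∈ Finset.Icc 1 (n + 1 - L),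
      (ρ ((i : ℤ) - (i' : ℤ)) + u n ((i : ℤ) - (i' : ℤ))) ^ 2) / n) atTop
      (𝓝 (∑' k, ρ k ^ 2)) := by
  simp_rw [fun n : ℕ => sum_sum_sub_eq_tsum (fun k => (ρ k + u n k) ^ 2) (n + 1 - L),
    ← tsum_div_const]
  refine tendsto_tsum_of_dominated_convergence ((hρ.mul_left 2).add (hg.mul_left 2))
    (fun k => ?_) ?_
  · have h1 := (tendsto_toNat_sub_abs_div L k).mul
      (((tendsto_const_nhds (x := ρ k)).add (hu k)).pow 2)
    rw [one_mul, add_zero] at h1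
    exact h1.congr fun n => by ring
  · filter_upwards [hb] with n hn k
    rw [Real.norm_of_nonneg (by positivity)]
    rcases lt_or_ge |k| ((n + 1 - L : ℕ) : ℤ) with hk | hk
    · have h1 : ((((n + 1 - L : ℕ) : ℤ) - |k|).toNat : ℝ) / n ≤ 1 := by
        refine div_le_one_of_le₀ ?_ (Nat.cast_nonneg n)
        have := abs_nonneg k
        -- Here `1 ≤ L` is what gives `n + 1 - L ≤ n`.
        have : (((n + 1 - L : ℕ) : ℤ) - |k|).toNat ≤ n := by omega
        exact_mod_cast this
      have h2 : u n k ^ 2 ≤ g k ^ 2 := sq_le_sq' (abs_le.1 (hn k hk)).1 (abs_le.1 (hn k hk)).2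
      calc ((((n + 1 - L : ℕ) : ℤ) - |k|).toNat : ℝ) * (ρ k + u n k) ^ 2 / n
          = ((((n + 1 - L : ℕ) : ℤ) - |k|).toNat : ℝ) / n * (ρ k + u n k) ^ 2 := by ring
        _ ≤ 1 * (ρ k + u n k) ^ 2 := mul_le_mul_of_nonneg_right h1 (sq_nonneg _)
        _ ≤ 2 * ρ k ^ 2 + 2 * g k ^ 2 := by linarith [sq_nonneg (ρ k - u n k)]
    · have : (((n + 1 - L : ℕ) : ℤ) - |k|).toNat = 0 := by omega
      rw [this, Nat.cast_zero, zero_mul, zero_div]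
      positivity

theorem summable_sq_of_le_rpow {f : ℤ → ℝ} (hf : ∀ k, f (-k) = f k) {K θ : ℝ} {L : ℕ}
    (hθ : θ < -(1 / 2)) (h : ∀ k : ℤ, (L : ℤ) ≤ k → |f k| ≤ K * ((k : ℝ) + 1 - L) ^ θ) :
    Summable fun k => f k ^ 2 := by
  have hnat : Summable fun n : ℕ => f (n : ℤ) ^ 2 := by
    rw [← summable_nat_add_iff L]
    have h1 : Summable fun n : ℕ => K ^ 2 * ((n + 1 : ℕ) : ℝ) ^ (2 * θ) :=
      ((summable_nat_add_iff 1).2 (Real.summable_nat_rpow.2 (by linarith))).mul_left _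
    refine h1.of_nonneg_of_le (fun n => sq_nonneg _) fun n => ?_
    have h2 := h ((n + L : ℕ) : ℤ) (by push_cast; omega)
    have e : ((((n + L : ℕ) : ℤ) : ℝ) + 1 - L) = ((n + 1 : ℕ) : ℝ) := by push_cast; ring
    rw [e] at h2
    have h3 := pow_le_pow_left₀ (abs_nonneg _) h2 2
    rw [sq_abs, mul_pow, ← Real.rpow_natCast (_ ^ θ), ← Real.rpow_mul (by positivity)] at h3
    rw [mul_comm 2 θ]
    exact_mod_cast h3
  exact Summable.of_nat_of_neg hnat (by simpa only [hf] using hnat)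

/-! ### Asymptotics of the covariances -/

section Asymptotics

variable {V : ℝ → ℝ} {D : ℕ} {C s α : ℝ} {a : ℤ →₀ ℝ} {M : ℕ}

/-- The relative error made when `V` is replaced by its leading irregular term in the covariances
of the discrete differences. -/
noncomputable def relativeError (V : ℝ → ℝ) (D : ℕ) (C s : ℝ) (b : ℤ →₀ ℝ) (δ : ℝ) (k : ℤ) : ℝ :=
  -discreteDiff b δ k (regularPart V D C s) / (C * (-1) ^ D * δ ^ (2 * (D : ℝ) + s))

theorem abs_relativeError (hC : 0 < C) (b : ℤ →₀ ℝ) {δ : ℝ} (hδ : 0 < δ) (k : ℤ) :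
    |relativeError V D C s b δ k| =
      |discreteDiff b δ k (regularPart V D C s)| / (C * δ ^ (2 * (D : ℝ) + s)) := by
  rw [relativeError, abs_div, abs_neg, abs_mul, abs_mul, abs_pow, abs_neg, abs_one, one_pow,
    mul_one, abs_of_pos hC, abs_of_pos (Real.rpow_pos_of_pos hδ _)]

/-- An exact identity: the power term is homogeneous in `δ`, and `relativeError` is by definition
what remains after normalization. -/
theorem neg_discreteDiff_eq (hC : 0 < C) (hs : 0 < s) {b : ℤ →₀ ℝ}
    (hb : ∀ k < 2 * D, moment b k = 0) {δ : ℝ} (hδ : 0 < δ) (k : ℤ) :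
    -discreteDiff b δ k V = C * (-1) ^ D * δ ^ (2 * (D : ℝ) + s) *
      (R k 1 (2 * D) (fun x => |x| ^ s) b + relativeError V D C s b δ k) := by
  have h1 : discreteDiff b δ k (regularPart V D C s) = discreteDiff b δ k V -
      C * (-1) ^ D / rpowConst s D * (δ ^ (2 * (D : ℝ) + s) *
        discreteDiff b 1 k fun x => |x| ^ (2 * (D : ℝ) + s)) := by
    simp only [discreteDiff, regularPart, mul_sub, Finset.sum_sub_distrib, Finset.mul_sum, mul_one]
    congr 1
    refine Finset.sum_congr rfl fun j _ => ?_
    rw [abs_mul, abs_of_pos hδ, Real.mul_rpow (abs_nonneg _) hδ.le]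
    ring
  rw [discreteDiff_abs_rpow hs D hb] at h1
  have h2 := (rpowConst_pos hs D).ne'
  have h3 := (Real.rpow_pos_of_pos hδ (2 * (D : ℝ) + s)).ne'
  have h4 : ((-1 : ℝ)) ^ D ≠ 0 := by simp
  have h5 : C * (-1) ^ D * δ ^ (2 * (D : ℝ) + s) ≠ 0 := mul_ne_zero (mul_ne_zero hC.ne' h4) h3
  rw [mul_add, relativeError, mul_div_cancel₀ _ h5, h1]
  field_simp
  ring

theorem step_pos (α : ℝ) {n : ℕ} (hn : 0 < n) : 0 < step α n :=
  Real.rpow_pos_of_pos (by exact_mod_cast hn) _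

theorem step_le_one (hα : 0 < α) {n : ℕ} (hn : 0 < n) : step α n ≤ 1 :=
  Real.rpow_le_one_of_one_le_of_nonpos (by exact_mod_cast hn) (by linarith)

theorem tendsto_step (hα : 0 < α) : Tendsto (step α) atTop (𝓝 0) :=
  (tendsto_rpow_neg_atTop hα).comp tendsto_natCast_atTop_atTop

theorem tendsto_relativeError (hα : 0 < α) (h : AssumptionH1 V D C s α) {b : ℤ →₀ ℝ}
    (hb : ∀ k ≤ 2 * D, moment b k = 0) (k : ℤ) :
    Tendsto (fun n => relativeError V D C s b (step α n) k) atTop (𝓝 0) := by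
  have h1 := ((discreteDiff_regularPart_isLittleO h hb k).comp_tendsto
    (tendsto_step hα)).tendsto_div_nhds_zero
  have h2 := h1.const_mul (-(C * (-1) ^ D)⁻¹)
  rw [mul_zero] at h2
  refine h2.congr' ?_
  filter_upwards [eventually_gt_atTop 0] with n hn
  simp only [Function.comp_apply, relativeError]
  rw [abs_of_pos (step_pos α hn)]
  have h3 := (Real.rpow_pos_of_pos (step_pos α hn) (2 * (D : ℝ) + s)).ne'
  have h4 : ((-1 : ℝ)) ^ D ≠ 0 := by simp
  have h5 := h.C_pos.ne'
  field_simp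

theorem R_abs_rpow_neg (hs : 0 < s) (hb : ∀ k < 2 * D, moment (seqConv a a) k = 0) (k : ℤ) :
    R (-k) 1 (2 * D) (fun x => |x| ^ s) (seqConv a a) =
      R k 1 (2 * D) (fun x => |x| ^ s) (seqConv a a) := by
  have h := discreteDiff_seqConv_neg a 1 k (f := fun x => |x| ^ (2 * (D : ℝ) + s))
    fun x => by rw [abs_neg]
  rw [discreteDiff_abs_rpow hs D hb, discreteDiff_abs_rpow hs D hb, neg_inj] at h
  exact mul_left_cancel₀ (rpowConst_pos hs D).ne' h

theorem summable_R_sq (hs : 0 < s) (ha : ∀ k < M, moment a k = 0)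
    (hM : (D : ℝ) + s / 2 + 1 / 4 < M) :
    Summable fun k : ℤ => R k 1 (2 * D) (fun x => |x| ^ s) (seqConv a a) ^ 2 := by
  have hb : ∀ k < 2 * M, moment (seqConv a a) k = 0 := fun k hk => moment_seqConv_self ha hk
  have hDM : D < M := by
    have : (D : ℝ) < M := by linarith
    exact_mod_cast this
  obtain ⟨m, hm⟩ : ∃ m, 2 * M = m + 1 := ⟨2 * M - 1, by omega⟩
  have hm' : (m : ℝ) + 1 = 2 * M := by exact_mod_cast hm.symm
  obtain ⟨K, -, hK⟩ := exists_abs_discreteDiff_abs_rpow_le (p := 2 * (D : ℝ) + s) (m := m)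
    (by linarith) (b := seqConv a a) (fun k hk => hb k (by omega))
    (L := seqLength a) fun j hj => abs_lt_seqLength_of_mem_support_seqConv hj
  have hc := rpowConst_pos hs D
  -- The decay exponent is `2D + s - 2M`; it is below `-1/2` precisely when `M > D + s/2 + 1/4`.
  refine summable_sq_of_le_rpow (R_abs_rpow_neg hs fun k hk => hb k (by omega))
    (K := K / rpowConst s D) (θ := 2 * (D : ℝ) + s - (m + 1)) (L := seqLength a)
    (by linarith) fun k hk => ?_
  have := hK k hk
  rw [discreteDiff_abs_rpow hs D fun k hk => hb k (by omega), abs_neg, abs_mul,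
    abs_of_pos hc] at this
  rw [div_mul_eq_mul_div, le_div_iff₀ hc]
  linarith

theorem regularPart_neg (hV : ∀ x, V (-x) = V x) (x : ℝ) :
    regularPart V D C s (-x) = regularPart V D C s x := by
  rw [regularPart, regularPart, hV, abs_neg]

theorem relativeError_neg (hV : ∀ x, V (-x) = V x) (δ : ℝ) (k : ℤ) :
    relativeError V D C s (seqConv a a) δ (-k) = relativeError V D C s (seqConv a a) δ k := by
  rw [relativeError, relativeError, discreteDiff_seqConv_neg a δ k (regularPart_neg hV)]

theorem exists_relativeError_le (hα : 0 < α) (hVe : ∀ x, V (-x) = V x) (hV : AssumptionH0 V)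
    (h : AssumptionH1 V D C s α) (h2 : AssumptionH2 V D C s α) (ha : ∀ k < M, moment a k = 0)
    (hM : (D : ℝ) + s / 2 + 1 / 4 < M) :
    ∃ g : ℤ → ℝ, (Summable fun k => g k ^ 2) ∧ ∀ᶠ n : ℕ in atTop, ∀ k : ℤ,
      |k| < ((n + 1 - seqLength a : ℕ) : ℤ) →
        |relativeError V D C s (seqConv a a) (step α n) k| ≤ g k := by
  have hb : ∀ k < 2 * M, moment (seqConv a a) k = 0 := fun k hk => moment_seqConv_self ha hk
  have hs := h.s_pos
  have hDM : D < M := by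
    have : (D : ℝ) < M := by linarith
    exact_mod_cast this
  obtain ⟨β, K, hβ1, hβ2, hK⟩ := h2
  obtain ⟨d, hd, hdM⟩ : ∃ d, remainderOrder s = d + 1 ∧ 2 * D + d + 1 ≤ 2 * M := by
    unfold remainderOrder
    split_ifs with h3
    · exact ⟨1, rfl, by omega⟩
    · refine ⟨2, rfl, ?_⟩
      -- For `s ≥ 3/2` one has `s/2 + 1/4 ≥ 1`, so `M ≥ D + 2` and there are enough vanishing
      -- moments for third-order control of the remainder.
      have : ((D + 1 : ℕ) : ℝ) < M := by push_cast; linarith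
      have : D + 1 < M := by exact_mod_cast this
      omega
  rw [hd] at hβ1 hK
  push_cast at hβ1
  set L := seqLength a
  obtain ⟨K', hK'0, hK'⟩ := exists_abs_discreteDiff_regularPart_le hV h (by linarith) hK
    (b := seqConv a a) (fun k hk => hb k (by omega))
    (L := L) fun j hj => abs_lt_seqLength_of_mem_support_seqConv hj
  -- The finitely many lags whose stencil may meet the origin are eventually bounded by `1`, since
  -- the error tends to `0` at each of them.
  set g : ℤ → ℝ := fun k => if |k| < (L : ℤ) then 1 else K' / C * (((|k| : ℤ) : ℝ) + 1 - L) ^ β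
    with hg
  refine ⟨g, ?_, ?_⟩
  · refine summable_sq_of_le_rpow (K := K' / C) (L := L) (θ := β)
      (fun k => by simp only [hg, abs_neg]) hβ2 fun k hk => ?_
    have hk0 : |k| = k := abs_of_nonneg (by omega)
    have hkL : (0 : ℝ) ≤ (k : ℝ) + 1 - L := by
      have : ((L : ℤ) : ℝ) ≤ k := by exact_mod_cast hk
      push_cast at this
      linarith
    simp only [hg, hk0]
    rw [if_neg (by omega), abs_of_nonneg
      (mul_nonneg (div_nonneg hK'0 h.C_pos.le) (Real.rpow_nonneg hkL _))]
  · have hsmall : ∀ᶠ n : ℕ in atTop, ∀ k ∈ Finset.Ioo (-(L : ℤ)) L,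
        |relativeError V D C s (seqConv a a) (step α n) k| ≤ 1 := by
      rw [Filter.eventually_all_finset]
      intro k _
      have h3 := (tendsto_relativeError hα h (fun k hk => hb k (by omega)) k).abs
      rw [abs_zero] at h3
      exact h3.eventually_le_const one_pos
    filter_upwards [hsmall, eventually_gt_atTop 0] with n hn hn0 k hk
    have hδ := step_pos α hn0
    rcases lt_or_ge |k| (L : ℤ) with hkL | hkL
    · simp only [hg]
      rw [if_pos hkL]
      exact hn k (Finset.mem_Ioo.2 (abs_lt.1 hkL))
    · have hpos : ∀ k : ℤ, (L : ℤ) ≤ k → k < ((n + 1 - L : ℕ) : ℤ) →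
          |relativeError V D C s (seqConv a a) (step α n) k| ≤
            K' / C * ((k : ℝ) + 1 - L) ^ β := by
        intro k hk1 hk2
        have hkL' : (0 : ℝ) ≤ (k : ℝ) + 1 - L := by
          have : ((L : ℤ) : ℝ) ≤ k := by exact_mod_cast hk1
          push_cast at this
          linarith
        have h3 := hK' k (step α n) hk1 hδ fun h1 => by
          -- With step `1/n`, the lags that occur keep the right end of the stencil below `1`.
          have hk3 : k + (L : ℤ) - 1 < n := by omega
          have hk4 : (k : ℝ) + L - 1 < n := by exact_mod_cast hk3
          have hn' : (0 : ℝ) < n := by exact_mod_cast hn0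
          rw [step, h1, Real.rpow_neg_one, ← div_eq_mul_inv]
          exact (div_lt_one hn').2 hk4
        -- As `β > s - (d + 1)`, the exponent exceeds `2D + s`; with `step α n ≤ 1` the bound on the
        -- relative error is uniform in `n`.
        have h4 : step α n ^ (2 * (D : ℝ) + (d + 1) + β) ≤ step α n ^ (2 * (D : ℝ) + s) :=
          Real.rpow_le_rpow_of_exponent_ge hδ (step_le_one hα hn0) (by linarith)
        have h5 := Real.rpow_pos_of_pos hδ (2 * (D : ℝ) + s)
        have h6 := Real.rpow_nonneg hkL' β
        have hC := h.C_pos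
        rw [abs_relativeError hC _ hδ, div_le_iff₀ (by positivity)]
        calc |discreteDiff (seqConv a a) (step α n) k (regularPart V D C s)|
            ≤ K' * step α n ^ (2 * (D : ℝ) + (d + 1) + β) * ((k : ℝ) + 1 - L) ^ β := h3
          _ ≤ K' * step α n ^ (2 * (D : ℝ) + s) * ((k : ℝ) + 1 - L) ^ β := by gcongr
          _ = K' / C * ((k : ℝ) + 1 - L) ^ β * (C * step α n ^ (2 * (D : ℝ) + s)) := by
              field_simp
      simp only [hg]
      rw [if_neg (by omega)]
      have habs : |relativeError V D C s (seqConv a a) (step α n) k| =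
          |relativeError V D C s (seqConv a a) (step α n) (|k|)| := by
        rcases abs_choice k with h1 | h1
        · rw [h1]
        · rw [h1, relativeError_neg hVe]
      rw [habs]
      exact hpos _ hkL hk

end Asymptotics

end QuadVar

/-! ### Mean and variance of the quadratic variation -/

theorem mainTheorem2 {Ω : Type*} [MeasurableSpace Ω] (μ : Measure Ω) [IsProbabilityMeasure μ]
    (X : ℝ → Ω → ℝ) (hGauss : IsGaussianProcess X μ) (hCentered : ∀ t, ∫ ω, X t ω ∂μ = 0)
    (hStat : QuadVar.HasStationaryIncrements X μ)
    (α : ℝ) (hα0 : 0 < α) (hα1 : α ≤ 1) (D : ℕ) (C s : ℝ)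
    (hH0 : QuadVar.AssumptionH0 (QuadVar.semivariogram X μ))
    (hH1 : QuadVar.AssumptionH1 (QuadVar.semivariogram X μ) D C s α)
    (a : ℤ →₀ ℝ) (M : ℕ) (hM : QuadVar.HasOrder a M) :
    (D < M →
      ((fun n : ℕ => ∫ ω, QuadVar.quadVariation X a α n ω ∂μ) ~[atTop]
        fun n : ℕ => (n : ℝ) * C * (-1) ^ D * (QuadVar.step α n) ^ (2 * (D : ℝ) + s) *
          QuadVar.R 0 1 (2 * D) (fun x => |x| ^ s) (QuadVar.seqConv a a)) ∧
      0 < (-1) ^ D * QuadVar.R 0 1 (2 * D) (fun x => |x| ^ s) (QuadVar.seqConv a a)) ∧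
    (QuadVar.AssumptionH2 (QuadVar.semivariogram X μ) D C s α →
      (D : ℝ) + s / 2 + 1 / 4 < (M : ℝ) →
      ((fun n : ℕ => variance (QuadVar.quadVariation X a α n) μ) ~[atTop]
        fun n : ℕ => 2 * (n : ℝ) * C ^ 2 * (QuadVar.step α n) ^ (4 * (D : ℝ) + 2 * s) *
          ∑' i : ℤ, (QuadVar.R i 1 (2 * D) (fun x => |x| ^ s) (QuadVar.seqConv a a)) ^ 2) ∧
      Summable (fun i : ℤ =>
        (QuadVar.R i 1 (2 * D) (fun x => |x| ^ s) (QuadVar.seqConv a a)) ^ 2) ∧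
      0 < ∑' i : ℤ, (QuadVar.R i 1 (2 * D) (fun x => |x| ^ s) (QuadVar.seqConv a a)) ^ 2) := by
  have hs := hH1.s_pos
  have hC := hH1.C_pos
  have hL := QuadVar.one_le_seqLength hM.ne_zero
  have hb : ∀ k < 2 * M, QuadVar.moment (QuadVar.seqConv a a) k = 0 :=
    fun k hk => QuadVar.moment_seqConv_self hM.1 hk
  have ha : D < M → ∑ j ∈ a.support, a j = 0 := fun hD => by
    simpa [QuadVar.moment] using hM.1 0 (by omega)
  have hpos := fun hD : D < M => QuadVar.R_zero_pos hs hH1.s_lt_two hM hD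
  refine ⟨fun hD => ⟨?_, hpos hD⟩, fun hH2 hDM => ?_⟩
  · have h0 : QuadVar.R 0 1 (2 * D) (fun x => |x| ^ s) (QuadVar.seqConv a a) ≠ 0 :=
      right_ne_zero_of_mul (hpos hD).ne'
    have ht := (QuadVar.tendsto_natCast_sub_div (QuadVar.seqLength a)).mul
      ((tendsto_const_nhds (x := QuadVar.R 0 1 (2 * D) (fun x => |x| ^ s)
        (QuadVar.seqConv a a))).add
        (QuadVar.tendsto_relativeError hα0 hH1 (fun k hk => hb k (by omega)) 0))
    rw [one_mul, add_zero] at ht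
    refine ((IsEquivalent.refl (u := fun n : ℕ => (n : ℝ) * C * (-1) ^ D *
      (QuadVar.step α n) ^ (2 * (D : ℝ) + s))).mul
      ((isEquivalent_const_iff_tendsto h0).2 ht)).congr_left ?_
    filter_upwards [eventually_gt_atTop 0] with n hn
    have hn' : (n : ℝ) ≠ 0 := by positivity
    rw [QuadVar.integral_quadVariation hGauss hStat (ha hD), QuadVar.neg_discreteDiff_eq (D := D) hC hs
      (fun k hk => hb k (by omega)) (QuadVar.step_pos α hn)]
    simp only [Pi.mul_apply]
    field_simp
  · have hD : D < M := by
      have : (D : ℝ) < M := by linarith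
      exact_mod_cast this
    have hsum := QuadVar.summable_R_sq hs hM.1 hDM
    have h0 : 0 < ∑' i : ℤ,
        (QuadVar.R i 1 (2 * D) (fun x => |x| ^ s) (QuadVar.seqConv a a)) ^ 2 :=
      -- The term at lag `0` is already non-zero, by the positivity in the first part.
      hsum.tsum_pos (fun i => sq_nonneg _) 0
        (pow_pos (abs_pos.2 (right_ne_zero_of_mul (hpos hD).ne')) 2 |>.trans_eq (sq_abs _))
    refine ⟨?_, hsum, h0⟩
    obtain ⟨g, hg, hbound⟩ := QuadVar.exists_relativeError_le hα0
      (QuadVar.semivariogram_neg hStat) hH0 hH1 hH2 hM.1 hDM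
    have ht := QuadVar.tendsto_sum_sum_sq (QuadVar.seqLength a) hsum hg
      (QuadVar.tendsto_relativeError hα0 hH1 fun k hk => hb k (by omega)) hbound hL
    refine ((IsEquivalent.refl (u := fun n : ℕ => 2 * (n : ℝ) * C ^ 2 *
      (QuadVar.step α n) ^ (4 * (D : ℝ) + 2 * s))).mul
      ((isEquivalent_const_iff_tendsto h0.ne').2 ht)).congr_left ?_
    filter_upwards [eventually_gt_atTop 0] with n hn
    have hn' : (n : ℝ) ≠ 0 := by positivity
    have e1 : QuadVar.step α n ^ (4 * (D : ℝ) + 2 * s) =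
        (QuadVar.step α n ^ (2 * (D : ℝ) + s)) ^ 2 := by
      rw [← Real.rpow_natCast, ← Real.rpow_mul (QuadVar.step_pos α hn).le]
      congr 1
      push_cast
      ring
    -- Squaring removes the sign `(-1)^D` and pulls the common scale out of the double sum.
    have e2 : ∀ k : ℤ, 2 * QuadVar.discreteDiff (QuadVar.seqConv a a) (QuadVar.step α n) k
        (QuadVar.semivariogram X μ) ^ 2 = 2 * C ^ 2 * QuadVar.step α n ^ (4 * (D : ℝ) + 2 * s) *
        (QuadVar.R k 1 (2 * D) (fun x => |x| ^ s) (QuadVar.seqConv a a) +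
          QuadVar.relativeError (QuadVar.semivariogram X μ) D C s (QuadVar.seqConv a a)
            (QuadVar.step α n) k) ^ 2 := by
      intro k
      have hsign : (((-1 : ℝ)) ^ D) ^ 2 = 1 := by rw [← pow_mul, mul_comm, pow_mul]; simp
      rw [← neg_sq, QuadVar.neg_discreteDiff_eq (D := D) hC hs (fun k hk => hb k (by omega))
        (QuadVar.step_pos α hn), e1, mul_pow, mul_pow, mul_pow, hsign]
      ring
    rw [QuadVar.variance_quadVariation hGauss hCentered hStat (ha hD)]
    simp_rw [e2, ← Finset.mul_sum]
    simp only [Pi.mul_apply]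
    field_simp
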